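/- Let $(M,\omega)$ be a closed (compact, without boundary) connected symplectic surface, with Poisson bracket $\{G,H\}=-\omega(X_G,X_H)$, where $-dH=\omega(X_H,\cdot)$. Let $\mathcal U=\{U_1,\dots,U_N\}$ be a finite cover of $M$ by open discs in general position: the $U_i$ have smooth boundaries, $\partial U_i$ and $\partial U_j$ are transverse for $i\ne j$, and $\partial U_i\cap\partial U_j\cap\partial U_k=\varnothing$ for distinct $i,j,k$. Let $\mathcal F=\{f_1,\dots,f_N\}$ be a positive collection subordinated to $\mathcal U$: the $f_i\ge 0$ are smooth, $\sum_i f_i\ge 1$ and $\operatorname{supp} f_i\subseteq U_i$. Put $$P_{\mathcal F}=\sum_{i,j=1}^N|\{f_i,f_j\}|,\qquad pb(\mathcal F)=\max_{a,b\in[-1,1]^N}\Big\|\Big\{\sum_i a_if_i,\sum_j b_jf_j\Big\}\Big\|_{\infty},\qquad c(\mathcal U)=\max_{1\le i\le N}\int_{U_i}\omega ,$$ and $\mathrm{Area}(M,\omega)=\int_M\omega$. Then for all $\epsilon,\eta>0$ there is a diffeomorphism $\phi:M\to M$ such that $\mathcal F'=\phi^*\mathcal F=\{f_i\circ\phi\}$,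 a positive collection subordinated to the open cover $\mathcal U'=\phi^*\mathcal U=\{\phi^{-1}(U_i)\}$, satisfies $$P_{\mathcal F'}<\frac{\int_M P_{\mathcal F}\,\omega}{\int_M\omega}+\epsilon\ \text{ everywhere on } M,$$ $$c(\mathcal U')<\max_{1\le i\le N}\frac{\int_{U_i}P_{\mathcal F}\,\omega}{\int_M P_{\mathcal F}\,\omega}\int_M\omega+\epsilon\quad\text{if } \int_M P_{\mathcal F}\,\omega>0,$$ $$pb(\mathcal F')\,\mathrm{Area}(M,\omega)<\int_M P_{\mathcal F}\,\omega+\eta,\qquad pb(\mathcal F')\,c(\mathcal U')<\max_{1\le i\le N}\int_{U_i}P_{\mathcal F}\,\omega+\eta .$$ -/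

import Mathlib

open Set MeasureTheory
open scoped Manifold ContDiff Topology

noncomputable section

namespace SymplecticSurface

/-- The model plane. -/
abbrev Plane : Type := EuclideanSpace ℝ (Fin 2)

variable {M : Type*} [TopologicalSpace M] [ChartedSpace Plane M]

variable (M) in
/-- A symplectic form on a surface `M`: a smooth, alternating, nondegenerate section of the bundle
of bilinear forms on the tangent spaces. Closedness is automatic, since there are no nonzero
3-forms on a surface. -/
structure SymplecticForm [IsManifold (𝓡 2) ∞ M] where
  /-- The bilinear form on the tangent space at each point. -/
  form : ∀ x : M, TangentSpace (𝓡 2) x →L[ℝ] TangentSpace (𝓡 2) x →L[ℝ] ℝ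
  alternating : ∀ (x : M) (v : TangentSpace (𝓡 2) x), form x v v = 0
  nondegenerate : ∀ (x : M) (v : TangentSpace (𝓡 2) x), (∀ w, form x v w = 0) → v = 0
  contMDiff : ContMDiff (𝓡 2) ((𝓡 2).prod 𝓘(ℝ, Plane →L[ℝ] Plane →L[ℝ] ℝ)) ∞
    (fun x ↦ Bundle.TotalSpace.mk' (Plane →L[ℝ] Plane →L[ℝ] ℝ)
      (E := fun y : M ↦ TangentSpace (𝓡 2) y →L[ℝ] TangentSpace (𝓡 2) y →L[ℝ] ℝ) x (form x))

section Bracket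

theorem finrank_tangent_eq (x : M) :
    Module.finrank ℝ (TangentSpace (𝓡 2) x) =
      Module.finrank ℝ (TangentSpace (𝓡 2) x →L[ℝ] ℝ) := by
  change Module.finrank ℝ Plane = Module.finrank ℝ (Plane →L[ℝ] ℝ)
  rw [← (LinearMap.toContinuousLinearMap (𝕜 := ℝ) (E := Plane) (F' := ℝ)).finrank_eq]
  exact (Subspace.dual_finrank_eq (K := ℝ) (V := Plane)).symm

variable [IsManifold (𝓡 2) ∞ M] (Ω : SymplecticForm M)

theorem flat_injective (x : M) :
    Function.Injective (Ω.form x : TangentSpace (𝓡 2) x →ₗ[ℝ] (TangentSpace (𝓡 2) x →L[ℝ] ℝ)) := by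
  rw [injective_iff_map_eq_zero]
  intro v hv
  refine Ω.nondegenerate x v fun w ↦ ?_
  have h : Ω.form x v = 0 := hv
  rw [h]
  rfl

/-- The isomorphism `v ↦ Ω(v, ·)` from tangent vectors to covectors at `x`. -/
def flat (x : M) : TangentSpace (𝓡 2) x ≃ₗ[ℝ] (TangentSpace (𝓡 2) x →L[ℝ] ℝ) :=
  haveI : FiniteDimensional ℝ (TangentSpace (𝓡 2) x) :=
    inferInstanceAs (FiniteDimensional ℝ Plane)
  haveI : FiniteDimensional ℝ (TangentSpace (𝓡 2) x →L[ℝ] ℝ) :=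
    inferInstanceAs (FiniteDimensional ℝ (Plane →L[ℝ] ℝ))
  LinearMap.linearEquivOfInjective
    (Ω.form x : TangentSpace (𝓡 2) x →ₗ[ℝ] (TangentSpace (𝓡 2) x →L[ℝ] ℝ))
    (flat_injective Ω x) (finrank_tangent_eq x)

/-- The symplectic gradient `X_H`, defined by `Ω(X_H, ·) = -dH`. -/
def symplecticGradient (H : M → ℝ) (x : M) : TangentSpace (𝓡 2) x :=
  (flat Ω x).symm (-(mfderiv (𝓡 2) 𝓘(ℝ, ℝ) H x))

/-- The defining equation of the symplectic gradient. -/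
theorem form_symplecticGradient (H : M → ℝ) (x : M) (v : TangentSpace (𝓡 2) x) :
    Ω.form x (symplecticGradient Ω H x) v = -(mfderiv (𝓡 2) 𝓘(ℝ, ℝ) H x v) := by
  have h : flat Ω x (symplecticGradient Ω H x) = -(mfderiv (𝓡 2) 𝓘(ℝ, ℝ) H x) :=
    (flat Ω x).apply_symm_apply _
  exact DFunLike.congr_fun h v

/-- The Poisson bracket `{G, H} = -Ω(X_G, X_H)`. -/
def poissonBracket (G H : M → ℝ) (x : M) : ℝ :=
  -(Ω.form x (symplecticGradient Ω G x) (symplecticGradient Ω H x))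

/-- The Poisson bracket function `P_F = ∑ i, ∑ j, |{f i, f j}|` of a finite collection. -/
def bracketFunction {N : ℕ} (f : Fin N → M → ℝ) (x : M) : ℝ :=
  ∑ i, ∑ j, |poissonBracket Ω (f i) (f j) x|

/-- The supremum norm of a real function. -/
def supNorm (g : M → ℝ) : ℝ := ⨆ x, |g x|

/-- The Poisson bracket invariant `pb(F)` of a finite collection: the maximum over
`a, b ∈ [-1, 1]^N` of the supremum norm of `{a · F, b · F}`. -/
def pb {N : ℕ} (f : Fin N → M → ℝ) : ℝ :=
  ⨆ c : (Fin N → Icc (-1 : ℝ) 1) × (Fin N → Icc (-1 : ℝ) 1),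
    supNorm (poissonBracket Ω (fun x ↦ ∑ i, (c.1 i : ℝ) * f i x)
      (fun x ↦ ∑ j, (c.2 j : ℝ) * f j x))

end Bracket

section Area

variable [IsManifold (𝓡 2) ∞ M] [MeasurableSpace M] (Ω : SymplecticForm M)

/-- The absolute value `|Ω(∂₁, ∂₂)|` of the coefficient of `Ω` in the chart `e`, as a function on
the target of `e`. -/
def chartDensity (e : OpenPartialHomeomorph M Plane) (y : Plane) : ℝ :=
  |Ω.form (e.symm y)
    (mfderiv (𝓡 2) (𝓡 2) e.symm y (EuclideanSpace.single (0 : Fin 2) (1 : ℝ) : Plane))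
    (mfderiv (𝓡 2) (𝓡 2) e.symm y (EuclideanSpace.single (1 : Fin 2) (1 : ℝ) : Plane))|

/-- The area measure of `Ω` on the source of the chart `e` (and zero outside): it gives to a set
`S` the mass `∫ |Ω(∂₁, ∂₂)| dy₁ dy₂` over the part of the target of `e` that corresponds to `S`. -/
def chartMeasure (e : OpenPartialHomeomorph M Plane) : Measure M :=
  ((volume.restrict e.target).withDensity
    fun y ↦ ENNReal.ofReal (chartDensity Ω e y)).map e.symm

/-- The measure on `M` that `Ω` defines, `M` being oriented by `Ω`. The area measures on the chart
domains agree on overlaps, and their supremum in the lattice of measures glues them. -/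
def areaMeasure : Measure M :=
  ⨆ e ∈ atlas Plane M, chartMeasure Ω e

/-- The total area `∫_M Ω`. -/
def area : ℝ := (areaMeasure Ω).real univ

/-- The capacity `c(U)` of a finite family of sets: the largest area of a member. -/
def capacity {N : ℕ} (U : Fin N → Set M) : ℝ := ⨆ i, (areaMeasure Ω).real (U i)

end Area

section Covers

/-- `U` is a finite open cover of `M`. -/
def IsOpenCover {N : ℕ} (U : Fin N → Set M) : Prop :=
  (∀ i, IsOpen (U i)) ∧ ⋃ i, U i = univ

/-- `U` is an open disc: it is diffeomorphic to the open unit disc, by a smooth chart of `M`. -/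
def IsOpenDisc [IsManifold (𝓡 2) ∞ M] (U : Set M) : Prop :=
  ∃ e ∈ IsManifold.maximalAtlas (𝓡 2) ∞ M, e.source = U ∧ e.target = Metric.ball (0 : Plane) 1

/-- `h` is a defining function of `U` at `p`: it is smooth, `U = {h < 0}` near `p`, and `dh ≠ 0`
at `p`. Near a boundary point `p`, the boundary of `U` is then the smooth curve `{h = 0}`. -/
def IsDefiningFunction (U : Set M) (p : M) (h : M → ℝ) : Prop :=
  ContMDiff (𝓡 2) 𝓘(ℝ, ℝ) ∞ h ∧ (∀ᶠ x in 𝓝 p, x ∈ U ↔ h x < 0) ∧ mfderiv (𝓡 2) 𝓘(ℝ, ℝ) h p ≠ 0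

/-- `U` has smooth boundary. -/
def HasSmoothBoundary (U : Set M) : Prop :=
  ∀ p ∈ frontier U, ∃ h, IsDefiningFunction U p h

/-- The boundaries of `U` and `V`, both smooth, intersect transversally: their tangent lines
`ker dh` and `ker dk` span the tangent plane at every common point. -/
def BoundariesTransverse (U V : Set M) : Prop :=
  ∀ p ∈ frontier U ∩ frontier V, ∀ h k, IsDefiningFunction U p h → IsDefiningFunction V p k →
    (mfderiv (𝓡 2) 𝓘(ℝ, ℝ) h p).ker ⊔ (mfderiv (𝓡 2) 𝓘(ℝ, ℝ) k p).ker = ⊤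

/-- The family `U` is in general position. -/
def InGeneralPosition {N : ℕ} (U : Fin N → Set M) : Prop :=
  (∀ i, HasSmoothBoundary (U i)) ∧
  (∀ i j, i ≠ j → BoundariesTransverse (U i) (U j)) ∧
  (∀ i j k, i ≠ j → j ≠ k → i ≠ k → frontier (U i) ∩ frontier (U j) ∩ frontier (U k) = ∅)

/-- `f` is a smooth positive collection: `f i ≥ 0` and `∑ i, f i ≥ 1`. -/
def IsPositiveCollection {N : ℕ} (f : Fin N → M → ℝ) : Prop :=
  (∀ i, ContMDiff (𝓡 2) 𝓘(ℝ, ℝ) ∞ (f i)) ∧ (∀ i x, 0 ≤ f i x) ∧ ∀ x, 1 ≤ ∑ i, f i x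

/-- The collection `f` is subordinated to the cover `U`: the (closed) support of `f i` lies in
`U i`. -/
def IsSubordinate {N : ℕ} (f : Fin N → M → ℝ) (U : Fin N → Set M) : Prop :=
  ∀ i, tsupport (f i) ⊆ U i

end Covers

end SymplecticSurface

end

open SymplecticSurface

/-!
The statement is a consequence of Moser's theorem for densities on a closed connected surface.
Write `P` for the bracket function of `f`. Given `δ > 0`, choose a smooth `ρ` with
`P < ρ < P + δ` and put `c = (∫ ρ) / area`. Moser's theorem gives a diffeomorphism `φ` that pulls
the density `ρ |Ω|` back to `c |Ω|` (`exists_transports_const`). In dimension two the bracket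
`{G, H}` is, up to sign, the quotient `dG ∧ dH / Ω`, so that under `φ` it is multiplied by the
Jacobian: `ρ(φ x) |{G ∘ φ, H ∘ φ}|(x) = c |{G, H}|(φ x)` (`abs_poissonBracket_comp`). Hence the
bracket function of the `f i ∘ φ` is at most `c ≤ (∫ P) / area + δ`, and so is `pb`, while
`c · area(φ⁻¹ U) = ∫_U ρ ≤ ∫_U P + δ · area` (`Transports.mul_real_preimage`). All the
inequalities follow for `δ` small.

Moser's theorem (`exists_transports_of_integral_eq`) is proved without flows or differential
forms. In coordinates, two positive densities on the plane that differ by the vertical derivative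
of a compactly supported function are exchanged by monotone rearrangement along the vertical
lines (`exists_fiber_transport`); the diffeomorphism is the identity outside the support of that
function, hence extends to the surface. Call a smooth function `g` *transportable* if every smooth
density `σ ≥ δ` can be carried to `σ + τ g` for `|τ|` small in terms of `δ` only. The
transportable functions form a linear subspace, which contains the functions `∂b / |Ω|` for `b`
compactly supported in a chart and `∂` a partial derivative. By the compactly supported Poincaré
lemma on a square (`exists_bump_forall_eq_add_fderiv`), the class modulo transportable functions
of a function supported near a point `p` is its integral times a class `β p`. Comparing bump
functions, `β` is locally constant, hence constant, and a partition of unity shows that every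
function of mean zero is transportable. Finally the segment from `ρ₀` to `ρ₁`, along which the
densities are bounded below, is covered by finitely many small steps.

The area measure is defined as a supremum of chart measures. The change of variables formula shows
that the chart measures agree on overlaps, so that they glue to one measure
(`areaMeasure_eq_chartMeasure`), and that transport of densities has the expected effect on
integrals (`Transports.setLIntegral_preimage`).
-/

set_option linter.unusedSectionVars false

/-! ### Fibrewise primitives and fibrewise transport in the plane -/

/-- The standard area form on `ℝ × ℝ`. -/
def cross (v w : ℝ × ℝ) : ℝ := v.1 * w.2 - v.2 * w.1

/-- The primitive `(x, y) ↦ ∫_{-∞}^y k(x, s) ds` of `k` along the vertical lines. -/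
noncomputable def fiberPrimitive (k : ℝ × ℝ → ℝ) (z : ℝ × ℝ) : ℝ := ∫ s in Iic z.2, k (z.1, s)

theorem HasCompactSupport.exists_bound {k : ℝ × ℝ → ℝ} (hk : HasCompactSupport k) :
    ∃ R : ℝ, 0 < R ∧ ∀ z : ℝ × ℝ, (R < |z.1| ∨ R < |z.2|) → k z = 0 := by
  obtain ⟨R, hR⟩ := hk.isCompact.isBounded.subset_closedBall (0 : ℝ × ℝ)
  refine ⟨max R 1, by positivity, fun z hz ↦ ?_⟩
  by_contra h
  have h1 : z ∈ Metric.closedBall (0 : ℝ × ℝ) R := hR (subset_tsupport _ h)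
  rw [mem_closedBall_zero_iff, Prod.norm_def, max_le_iff, Real.norm_eq_abs, Real.norm_eq_abs] at h1
  rcases hz with hz | hz
  · exact absurd h1.1 (not_le.2 ((le_max_left _ _).trans_lt hz))
  · exact absurd h1.2 (not_le.2 ((le_max_left _ _).trans_lt hz))

theorem HasCompactSupport.fiber {k : ℝ × ℝ → ℝ} (hk : HasCompactSupport k) (x : ℝ) :
    HasCompactSupport fun s ↦ k (x, s) := by
  obtain ⟨R, -, hR⟩ := hk.exists_bound
  refine HasCompactSupport.intro (isCompact_Icc (a := -R) (b := R)) fun s hs ↦ hR _ (Or.inr ?_)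
  rw [mem_Icc, ← abs_le] at hs
  exact not_le.1 hs

theorem integrable_fiber {k : ℝ × ℝ → ℝ} (hk : Continuous k) (hc : HasCompactSupport k) (x : ℝ) :
    Integrable fun s ↦ k (x, s) :=
  (by fun_prop : Continuous fun s ↦ k (x, s)).integrable_of_hasCompactSupport (hc.fiber x)

/-- Smoothness in both variables at once; it comes from the theory of convolutions with a
parameter, the parameter being the first coordinate. -/
theorem contDiff_fiberPrimitive {k : ℝ × ℝ → ℝ} (hk : ContDiff ℝ ∞ k) (hc : HasCompactSupport k) :
    ContDiff ℝ ∞ (fiberPrimitive k) := by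
  obtain ⟨R, -, hR⟩ := hc.exists_bound
  -- the primitive is the convolution, along the fibres, with the indicator function of `[0, ∞)`
  have key := contDiffOn_convolution_right_with_param (n := ⊤) (μ := volume)
    (ContinuousLinearMap.lsmul ℝ ℝ) (f := (Ici (0 : ℝ)).indicator fun _ ↦ (1 : ℝ))
    (g := fun x s ↦ k (x, s)) (s := univ) (k := Icc (-R) R) isOpen_univ isCompact_Icc
    (fun p x _ hx ↦ hR _ (Or.inr (by rw [mem_Icc, ← abs_le] at hx; exact not_le.1 hx)))
    ((locallyIntegrable_const _).indicator measurableSet_Ici)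
    (by
      rw [univ_prod_univ, contDiffOn_univ]
      exact hk)
  rw [univ_prod_univ, contDiffOn_univ] at key
  convert! key using 1
  funext z
  simp only [convolution, fiberPrimitive, ContinuousLinearMap.lsmul_apply, smul_eq_mul]
  rw [← integral_indicator measurableSet_Iic, ← integral_sub_left_eq_self _ volume z.2]
  congr 1
  funext t
  by_cases ht : 0 ≤ t <;> simp [indicator, ht]

theorem hasDerivAt_fiberPrimitive {k : ℝ × ℝ → ℝ} (hk : Continuous k) (hc : HasCompactSupport k)
    (x y : ℝ) : HasDerivAt (fun s ↦ fiberPrimitive k (x, s)) (k (x, y)) y := by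
  have hi := integrable_fiber hk hc x
  have h1 : (fun s ↦ fiberPrimitive k (x, s)) =
      fun s ↦ fiberPrimitive k (x, 0) + ∫ t in (0 : ℝ)..s, k (x, t) := by
    funext s
    rw [← intervalIntegral.integral_Iic_sub_Iic hi.integrableOn hi.integrableOn]
    simp [fiberPrimitive]
  rw [h1]
  have hcont : Continuous fun t ↦ k (x, t) := by fun_prop
  exact (intervalIntegral.integral_hasDerivAt_right (hi.intervalIntegrable)
    hcont.aestronglyMeasurable.stronglyMeasurableAtFilter hcont.continuousAt).const_add _

theorem hasDerivAt_fiber {F : ℝ × ℝ → ℝ} {x y : ℝ} (hF : DifferentiableAt ℝ F (x, y)) :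
    HasDerivAt (fun s ↦ F (x, s)) (fderiv ℝ F (x, y) (0, 1)) y := by
  have h : HasDerivAt (fun s : ℝ ↦ (x, s)) ((0 : ℝ), (1 : ℝ)) y :=
    (hasDerivAt_const y x).prodMk (hasDerivAt_id y)
  exact hF.hasFDerivAt.comp_hasDerivAt y h

theorem fderiv_fiberPrimitive {k : ℝ × ℝ → ℝ} (hk : ContDiff ℝ ∞ k) (hc : HasCompactSupport k)
    (z : ℝ × ℝ) : fderiv ℝ (fiberPrimitive k) z (0, 1) = k z :=
  (hasDerivAt_fiber ((contDiff_fiberPrimitive hk hc).differentiable (by simp) z)).unique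
    (hasDerivAt_fiberPrimitive hk.continuous hc z.1 z.2)

/-- A map of the plane that preserves the vertical lines and restricts to an increasing bijection
of each of them with positive derivative is a diffeomorphism. -/
theorem exists_fiber_diffeomorph {F : ℝ × ℝ → ℝ} (hF : ContDiff ℝ ∞ F)
    (hpos : ∀ z, 0 < fderiv ℝ F z (0, 1)) (hsurj : ∀ x, Function.Surjective fun y ↦ F (x, y)) :
    ∃ Φ : (ℝ × ℝ) ≃ₘ^∞⟮𝓘(ℝ, ℝ × ℝ), 𝓘(ℝ, ℝ × ℝ)⟯ (ℝ × ℝ), ∀ z, Φ z = (z.1, F z) := by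
  have hmono (x : ℝ) : StrictMono fun y ↦ F (x, y) := by
    refine strictMono_of_deriv_pos fun y ↦ ?_
    rw [(hasDerivAt_fiber (hF.differentiable (by simp) _)).deriv]
    exact hpos _
  set G : ℝ × ℝ → ℝ × ℝ := fun z ↦ (z.1, F z) with hG
  have hGs : ContDiff ℝ ∞ G := contDiff_fst.prodMk hF
  have hbij : Function.Bijective G := by
    constructor
    · rintro ⟨x, y⟩ ⟨x', y'⟩ h
      simp only [hG, Prod.mk.injEq] at h
      obtain ⟨rfl, h⟩ := h
      rw [(hmono x).injective h]
    · rintro ⟨x, y⟩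
      obtain ⟨s, hs⟩ := hsurj x y
      exact ⟨(x, s), Prod.ext rfl hs⟩
  have hder (z : ℝ × ℝ) : HasFDerivAt G
      ((ContinuousLinearMap.fst ℝ ℝ ℝ).prod (fderiv ℝ F z)) z :=
    hasFDerivAt_fst.prodMk (hF.differentiable (by simp) z).hasFDerivAt
  have hinj (z : ℝ × ℝ) : Function.Injective
      ((ContinuousLinearMap.fst ℝ ℝ ℝ).prod (fderiv ℝ F z) : (ℝ × ℝ) →ₗ[ℝ] (ℝ × ℝ)) := by
    rw [injective_iff_map_eq_zero]
    rintro ⟨v₁, v₂⟩ hv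
    have h1 : v₁ = 0 := congrArg Prod.fst hv
    have h2 : fderiv ℝ F z (v₁, v₂) = 0 := congrArg Prod.snd hv
    have h3 : ((v₁, v₂) : ℝ × ℝ) = v₂ • ((0 : ℝ), (1 : ℝ)) := by simp [h1]
    rw [h3, map_smul, smul_eq_mul, mul_eq_zero] at h2
    rw [h1, h2.resolve_right (hpos z).ne']
    rfl
  set L : ℝ × ℝ → (ℝ × ℝ) ≃L[ℝ] (ℝ × ℝ) := fun z ↦
    (LinearEquiv.ofInjectiveEndo _ (hinj z)).toContinuousLinearEquiv with hL
  have hder' (z : ℝ × ℝ) : HasFDerivAt G (L z : (ℝ × ℝ) →L[ℝ] (ℝ × ℝ)) z := by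
    convert hder z using 1
    ext <;> simp [hL]
  have hopen : IsOpenMap G := isOpenMap_of_hasStrictFDerivAt_equiv fun z ↦
    hGs.contDiffAt.hasStrictFDerivAt' (hder' z) (by simp)
  let H : (ℝ × ℝ) ≃ₜ (ℝ × ℝ) :=
    (Equiv.ofBijective G hbij).toHomeomorphOfContinuousOpen hGs.continuous hopen
  have hsymm : ContDiff ℝ ∞ H.symm := H.contDiff_symm (f₀' := L) hder' hGs
  exact ⟨⟨H.toEquiv, hGs.contMDiff, hsymm.contMDiff⟩, fun z ↦ rfl⟩

theorem cross_prod_fderiv {F : ℝ × ℝ → ℝ} {z : ℝ × ℝ} (v w : ℝ × ℝ) :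
    cross (v.1, fderiv ℝ F z v) (w.1, fderiv ℝ F z w) = fderiv ℝ F z (0, 1) * cross v w := by
  have h (u : ℝ × ℝ) : fderiv ℝ F z u =
      u.1 * fderiv ℝ F z (1, 0) + u.2 * fderiv ℝ F z (0, 1) := by
    have : u = u.1 • ((1 : ℝ), (0 : ℝ)) + u.2 • ((0 : ℝ), (1 : ℝ)) := by ext <;> simp
    conv_lhs => rw [this, map_add, map_smul, map_smul, smul_eq_mul, smul_eq_mul]
  simp only [cross, h v, h w]
  ring

/-- One-dimensional optimal transport along the vertical lines: two densities on the plane that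
differ by the vertical derivative of a compactly supported function `b` are exchanged by a
diffeomorphism that moves no zero of `b`. -/
theorem exists_fiber_transport {σ b : ℝ × ℝ → ℝ} (hσ : ContDiff ℝ ∞ σ)
    (hσ1 : HasCompactSupport fun z ↦ σ z - 1) (hb : ContDiff ℝ ∞ b) (hbc : HasCompactSupport b)
    (hpos : ∀ z, 0 < σ z) (hpos' : ∀ z, 0 < σ z + fderiv ℝ b z (0, 1)) :
    ∃ Φ : (ℝ × ℝ) ≃ₘ^∞⟮𝓘(ℝ, ℝ × ℝ), 𝓘(ℝ, ℝ × ℝ)⟯ (ℝ × ℝ), (∀ z, b z = 0 → Φ z = z) ∧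
      ∀ z v w, (σ (Φ z) + fderiv ℝ b (Φ z) (0, 1)) *
        cross (fderiv ℝ Φ z v) (fderiv ℝ Φ z w) = σ z * cross v w := by
  have hk : ContDiff ℝ ∞ fun z ↦ σ z - 1 := hσ.sub contDiff_const
  set B := fiberPrimitive fun z ↦ σ z - 1 with hB
  have hBs : ContDiff ℝ ∞ B := contDiff_fiberPrimitive hk hσ1
  -- `F₀` and `F₁` are vertical primitives of the two densities
  set F₀ : ℝ × ℝ → ℝ := fun z ↦ z.2 + B z with hF₀
  set F₁ : ℝ × ℝ → ℝ := fun z ↦ F₀ z + b z with hF₁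
  have hF₀s : ContDiff ℝ ∞ F₀ := contDiff_snd.add hBs
  have hF₁s : ContDiff ℝ ∞ F₁ := hF₀s.add hb
  have hd₀ (z : ℝ × ℝ) : fderiv ℝ F₀ z (0, 1) = σ z := by
    rw [hF₀, fderiv_fun_add differentiableAt_snd (hBs.differentiable (by simp) z)]
    simp [fderiv_snd, hB, fderiv_fiberPrimitive hk hσ1]
  have hd₁ (z : ℝ × ℝ) : fderiv ℝ F₁ z (0, 1) = σ z + fderiv ℝ b z (0, 1) := by
    rw [hF₁, fderiv_fun_add (hF₀s.differentiable (by simp) z) (hb.differentiable (by simp) z),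
      ← hd₀ z]
    rfl
  obtain ⟨R, -, hR⟩ := hσ1.exists_bound
  have hsurj {c : ℝ × ℝ → ℝ} (hc : ContDiff ℝ ∞ c) (hcc : HasCompactSupport c) (x : ℝ) :
      Function.Surjective fun y ↦ F₀ (x, y) + c (x, y) := by
    obtain ⟨R', -, hR'⟩ := hcc.exists_bound
    have hcont : Continuous c := hc.continuous
    refine (by fun_prop : Continuous fun y ↦ F₀ (x, y) + c (x, y)).surjective ?_ ?_
    · have h : (fun y ↦ y + ∫ s, (σ (x, s) - 1)) =ᶠ[Filter.atTop]
          fun y ↦ F₀ (x, y) + c (x, y) := by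
        filter_upwards [Filter.eventually_gt_atTop R, Filter.eventually_gt_atTop R'] with y hy hy'
        have h1 : c (x, y) = 0 := hR' _ (Or.inr (hy'.trans_le (le_abs_self _)))
        have h2 : B (x, y) = ∫ s, (σ (x, s) - 1) := by
          refine setIntegral_eq_integral_of_forall_compl_eq_zero fun s hs ↦ hR _ (Or.inr ?_)
          have : y < s := not_le.1 hs
          exact (hy.trans this).trans_le (le_abs_self _)
        simp [hF₀, h1, h2]
      exact (Filter.tendsto_atTop_add_const_right _ _ Filter.tendsto_id).congr' h
    · have h : (fun y ↦ y) =ᶠ[Filter.atBot] fun y ↦ F₀ (x, y) + c (x, y) := by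
        filter_upwards [Filter.eventually_lt_atBot (-R), Filter.eventually_lt_atBot (-R')]
          with y hy hy'
        have h1 : c (x, y) = 0 := hR' _ (Or.inr (by linarith [neg_abs_le y]))
        have h2 : B (x, y) = 0 := by
          refine setIntegral_eq_zero_of_forall_eq_zero fun s hs ↦ hR _ (Or.inr ?_)
          have : s ≤ y := hs
          change R < |s|
          linarith [neg_abs_le s]
        simp [hF₀, h1, h2]
      exact Filter.tendsto_id.congr' h
  have hsurj₀ (x : ℝ) : Function.Surjective fun y ↦ F₀ (x, y) := by
    simpa using hsurj (contDiff_const (c := (0 : ℝ))) HasCompactSupport.zero x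
  obtain ⟨Φ₀, hΦ₀⟩ := exists_fiber_diffeomorph hF₀s (fun z ↦ (hd₀ z).symm ▸ hpos z) hsurj₀
  obtain ⟨Φ₁, hΦ₁⟩ := exists_fiber_diffeomorph hF₁s (fun z ↦ (hd₁ z).symm ▸ hpos' z) (hsurj hb hbc)
  -- the monotone rearrangement `F₁⁻¹ ∘ F₀` on each line
  refine ⟨Φ₀.trans Φ₁.symm, fun z hz ↦ ?_, fun z v w ↦ ?_⟩
  · rw [Diffeomorph.coe_trans, Function.comp_apply]
    refine Φ₁.injective ?_
    change Φ₁ _ = Φ₁ _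
    rw [Diffeomorph.apply_symm_apply, hΦ₀, hΦ₁, hF₁]
    simp [hz]
  · set Φ := Φ₀.trans Φ₁.symm with hΦ
    have hcomp : Φ₁ ∘ Φ = Φ₀ := by
      funext z
      simp [hΦ]
    have hfd {F : ℝ × ℝ → ℝ} (hF : ContDiff ℝ ∞ F)
        {Ψ : (ℝ × ℝ) ≃ₘ^∞⟮𝓘(ℝ, ℝ × ℝ), 𝓘(ℝ, ℝ × ℝ)⟯ (ℝ × ℝ)} (hΨ : ∀ z, Ψ z = (z.1, F z))
        (z u : ℝ × ℝ) : fderiv ℝ Ψ z u = (u.1, fderiv ℝ F z u) := by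
      have h1 : (Ψ : ℝ × ℝ → ℝ × ℝ) = fun z ↦ (z.1, F z) := funext hΨ
      rw [h1, (hasFDerivAt_fst.prodMk (hF.differentiable (by simp) z).hasFDerivAt).fderiv]
      rfl
    have hchain (u : ℝ × ℝ) : fderiv ℝ Φ₁ (Φ z) (fderiv ℝ Φ z u) = fderiv ℝ Φ₀ z u := by
      rw [← hcomp, fderiv_comp z (Φ₁.contDiff.differentiable (by simp) _)
        (Φ.contDiff.differentiable (by simp) _)]
      rfl
    rw [← hd₁ (Φ z), ← cross_prod_fderiv, ← hfd hF₁s hΦ₁, ← hfd hF₁s hΦ₁, hchain, hchain,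
      hfd hF₀s hΦ₀, hfd hF₀s hΦ₀, cross_prod_fderiv, hd₀]

/-! ### The compactly supported Poincaré lemma on a square -/

/-- A compactly supported function whose integrals along the vertical lines vanish is the vertical
derivative of a function supported in the same square. -/
theorem exists_fderiv_vertical_eq {k : ℝ × ℝ → ℝ} (hk : ContDiff ℝ ∞ k) {z₀ : ℝ × ℝ} {s : ℝ}
    (hs : ∀ z, z ∉ Metric.closedBall z₀ s → k z = 0) (hint : ∀ x, ∫ t, k (x, t) = 0) :
    ∃ b : ℝ × ℝ → ℝ, ContDiff ℝ ∞ b ∧ (∀ z, z ∉ Metric.closedBall z₀ s → b z = 0) ∧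
      ∀ z, fderiv ℝ b z (0, 1) = k z := by
  have hc : HasCompactSupport k := HasCompactSupport.intro (isCompact_closedBall z₀ s) fun z ↦ hs z
  have hs' (x y : ℝ) (h : s < |x - z₀.1| ∨ s < |y - z₀.2|) : k (x, y) = 0 := by
    refine hs _ fun hz ↦ ?_
    rw [Metric.mem_closedBall, Prod.dist_eq, max_le_iff, Real.dist_eq, Real.dist_eq] at hz
    rcases h with h | h
    · exact absurd hz.1 (not_le.2 h)
    · exact absurd hz.2 (not_le.2 h)
  -- above the square the primitive is the full fibre integral, which vanishes
  refine ⟨fiberPrimitive k, contDiff_fiberPrimitive hk hc, fun z hz ↦ ?_,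
    fderiv_fiberPrimitive hk hc⟩
  rw [Metric.mem_closedBall, Prod.dist_eq, max_le_iff, Real.dist_eq, Real.dist_eq, not_and_or,
    not_le, not_le, lt_abs (a := s) (b := z.2 - _)] at hz
  rcases hz with hz | hz | hz
  · exact setIntegral_eq_zero_of_forall_eq_zero fun t _ ↦ hs' _ _ (Or.inl hz)
  · rw [fiberPrimitive, setIntegral_eq_integral_of_forall_compl_eq_zero, hint]
    intro t ht
    have : z.2 < t := not_le.1 ht
    exact hs' _ _ (Or.inr (lt_abs.2 (Or.inl (by linarith))))
  · refine setIntegral_eq_zero_of_forall_eq_zero fun t ht ↦ hs' _ _ (Or.inr (lt_abs.2 (Or.inr ?_)))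
    have : t ≤ z.2 := ht
    linarith

/-- The compactly supported Poincaré lemma in degree two on a square: up to a multiple of a fixed
bump function, a function supported in the square is a sum of partial derivatives of functions
supported in the square. -/
theorem exists_bump_forall_eq_add_fderiv (z₀ : ℝ × ℝ) {r : ℝ} (hr : 0 < r) :
    ∃ κ : ℝ × ℝ → ℝ, ContDiff ℝ ∞ κ ∧ HasCompactSupport κ ∧ tsupport κ ⊆ Metric.ball z₀ r ∧
      ∀ h : ℝ × ℝ → ℝ, ContDiff ℝ ∞ h → tsupport h ⊆ Metric.ball z₀ r → ∃ a b : ℝ × ℝ → ℝ,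
        (ContDiff ℝ ∞ a ∧ HasCompactSupport a ∧ tsupport a ⊆ Metric.ball z₀ r) ∧
        (ContDiff ℝ ∞ b ∧ HasCompactSupport b ∧ tsupport b ⊆ Metric.ball z₀ r) ∧
        ∀ z, h z = (∫ z, h z) * κ z + fderiv ℝ a z (1, 0) + fderiv ℝ b z (0, 1) := by
  have hsup {f : ℝ × ℝ → ℝ} {s : ℝ} (hsr : s < r)
      (hf : ∀ z, z ∉ Metric.closedBall z₀ s → f z = 0) :
      HasCompactSupport f ∧ tsupport f ⊆ Metric.ball z₀ r :=
    ⟨HasCompactSupport.intro (isCompact_closedBall z₀ s) fun z ↦ hf z,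
      (closure_minimal (fun z (hz : f z ≠ 0) ↦ by_contra fun h ↦ hz (hf z h))
        Metric.isClosed_closedBall).trans
        (Metric.closedBall_subset_ball hsr)⟩
  let χ (x : ℝ) : ContDiffBump x := ⟨r / 4, r / 2, by positivity, by linarith⟩
  set χ₁ : ℝ → ℝ := (χ z₀.1).normed volume with hχ₁
  set χ₂ : ℝ → ℝ := (χ z₀.2).normed volume with hχ₂
  have hχ₁s : ContDiff ℝ ∞ χ₁ := (χ z₀.1).contDiff_normed
  have hχ₂s : ContDiff ℝ ∞ χ₂ := (χ z₀.2).contDiff_normed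
  have hχz (x y : ℝ) (h : r / 2 < |y - x|) : (χ x).normed volume y = 0 := by
    by_contra h0
    have h1 : y ∈ Metric.closedBall x (r / 2) := by
      rw [← (χ x).tsupport_normed_eq (μ := volume)]
      exact subset_tsupport _ h0
    rw [Metric.mem_closedBall, Real.dist_eq] at h1
    exact absurd h1 (not_le.2 h)
  have hχi (x : ℝ) : ∫ y, (χ x).normed volume y = 1 := (χ x).integral_normed
  have hnot {z : ℝ × ℝ} {w : ℝ × ℝ} {s : ℝ} : z ∉ Metric.closedBall w s ↔
      s < |z.1 - w.1| ∨ s < |z.2 - w.2| := by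
    rw [Metric.mem_closedBall, Prod.dist_eq, max_le_iff, Real.dist_eq, Real.dist_eq, not_and_or,
      not_le, not_le]
  have hκ : ∀ z, z ∉ Metric.closedBall z₀ (r / 2) → χ₁ z.1 * χ₂ z.2 = 0 := by
    intro z hz
    rcases hnot.1 hz with hz | hz
    · rw [hχ₁, hχz _ _ hz, zero_mul]
    · rw [hχ₂, hχz _ _ hz, mul_zero]
  refine ⟨fun z ↦ χ₁ z.1 * χ₂ z.2, by fun_prop, (hsup (by linarith) hκ).1,
    (hsup (by linarith) hκ).2, fun h hh hhs ↦ ?_⟩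
  obtain ⟨r', hr', hsub⟩ := exists_lt_subset_ball (isClosed_tsupport h) hhs
  set s := max r' (r / 2) with hs
  have hsr : s < r := max_lt hr' (by linarith)
  have hs2 : r / 2 ≤ s := le_max_right _ _
  have hz : ∀ z, z ∉ Metric.closedBall z₀ s → h z = 0 := fun z hz ↦ by
    by_contra h0
    exact hz ((Metric.ball_subset_closedBall.trans
      (Metric.closedBall_subset_closedBall (le_max_left _ _))) (hsub (subset_tsupport _ h0)))
  have hc : HasCompactSupport h := (hsup hsr hz).1
  set H : ℝ → ℝ := fun x ↦ ∫ t, h (x, t) with hH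
  have hHs : ContDiff ℝ ∞ H := by
    have h1 : H = fun x ↦ fiberPrimitive h (x, z₀.2 + s) := by
      funext x
      refine (setIntegral_eq_integral_of_forall_compl_eq_zero fun t ht ↦ hz _ ?_).symm
      have : z₀.2 + s < t := not_le.1 ht
      exact hnot.2 (Or.inr (lt_abs.2 (Or.inl (by change s < t - z₀.2; linarith))))
    rw [h1]
    exact (contDiff_fiberPrimitive hh hc).comp (contDiff_id.prodMk contDiff_const)
  have hHz (x : ℝ) (hx : s < |x - z₀.1|) : H x = 0 := by
    simp only [hH]
    rw [← integral_zero ℝ ℝ]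
    congr 1
    funext t
    exact hz _ (hnot.2 (Or.inl hx))
  have hHi : Integrable H := hHs.continuous.integrable_of_hasCompactSupport <|
    HasCompactSupport.intro (isCompact_closedBall z₀.1 s) fun x hx ↦ hHz x <| by
      rwa [Metric.mem_closedBall, Real.dist_eq, not_le] at hx
  have hHint : ∫ x, H x = ∫ z, h z :=
    (integral_prod h (hh.continuous.integrable_of_hasCompactSupport hc)).symm
  -- subtract the fibrewise integrals, spread out with the profile `χ₂`
  obtain ⟨b, hbs, hbz, hb⟩ := exists_fderiv_vertical_eq (k := fun z ↦ h z - H z.1 * χ₂ z.2)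
    (by fun_prop) (z₀ := z₀) (s := s)
    (fun z hzz ↦ by
      rw [hz z hzz]
      rcases hnot.1 hzz with hzz | hzz
      · rw [hHz _ hzz]; ring
      · rw [hχ₂, hχz _ _ (hs2.trans_lt hzz)]; ring)
    (fun x ↦ by
      change ∫ t, (h (x, t) - H x * χ₂ t) = 0
      rw [integral_sub (integrable_fiber hh.continuous hc x)
        (((χ z₀.2).integrable_normed).const_mul _), integral_const_mul, hχi]
      simp [hH])
  -- the remaining function of `x` is treated in the same way after exchanging the coordinates
  obtain ⟨a, has, haz, ha⟩ := exists_fderiv_vertical_eq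
    (k := fun z ↦ χ₂ z.1 * (H z.2 - (∫ z, h z) * χ₁ z.2))
    (by fun_prop) (z₀ := z₀.swap) (s := s)
    (fun z hzz ↦ by
      rcases hnot.1 hzz with hzz | hzz
      · rw [hχ₂, hχz _ _ (hs2.trans_lt hzz)]; ring
      · rw [hHz _ hzz, hχ₁, hχz _ _ (hs2.trans_lt hzz)]; ring)
    (fun x ↦ by
      change ∫ t, χ₂ x * (H t - (∫ z, h z) * χ₁ t) = 0
      rw [integral_const_mul, integral_sub hHi (((χ z₀.1).integrable_normed).const_mul _),
        integral_const_mul, hχi, hHint]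
      ring)
  have haz' : ∀ z, z ∉ Metric.closedBall z₀ s → (a ∘ Prod.swap) z = 0 := fun z hzz ↦
    haz _ (hnot.2 ((hnot.1 hzz).symm))
  refine ⟨a ∘ Prod.swap, b, ⟨has.comp (contDiff_snd.prodMk contDiff_fst), hsup hsr haz'⟩,
    ⟨hbs, hsup hsr hbz⟩, fun z ↦ ?_⟩
  have hswap : fderiv ℝ (a ∘ Prod.swap) z (1, 0) = fderiv ℝ a z.swap (0, 1) := by
    have h1 : HasFDerivAt (Prod.swap : ℝ × ℝ → ℝ × ℝ)
        ((ContinuousLinearMap.snd ℝ ℝ ℝ).prod (ContinuousLinearMap.fst ℝ ℝ ℝ)) z :=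
      hasFDerivAt_snd.prodMk hasFDerivAt_fst
    rw [((has.differentiable (by simp) z.swap).hasFDerivAt.comp z h1).fderiv]
    rfl
  rw [hswap, ha, hb]
  simp only [Prod.fst_swap, Prod.snd_swap]
  ring

/-! ### Planar coordinates on a symplectic surface -/

section Coordinates

variable {M : Type*} [TopologicalSpace M] [ChartedSpace Plane M] [IsManifold (𝓡 2) ∞ M]
  (Ω : SymplecticForm M)

theorem form_swap (x : M) (v w : TangentSpace (𝓡 2) x) : Ω.form x v w = -Ω.form x w v := by
  have h := Ω.alternating x (v + w)
  simp only [map_add, add_apply, Ω.alternating] at h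
  linarith

/-- On a surface, an alternating form pulled back to `ℝ × ℝ` is a multiple of `cross`. -/
theorem form_apply_linear {x : M} (A : (ℝ × ℝ) →L[ℝ] TangentSpace (𝓡 2) x) (v w : ℝ × ℝ) :
    Ω.form x (A v) (A w) = cross v w * Ω.form x (A (1, 0)) (A (0, 1)) := by
  have h (u : ℝ × ℝ) : A u = u.1 • A (1, 0) + u.2 • A (0, 1) := by
    rw [← map_smul, ← map_smul, ← map_add]
    congr 1
    ext <;> simp
  rw [h v, h w]
  simp only [map_add, map_smul, add_apply, smul_apply,
    Ω.alternating, smul_eq_mul, form_swap Ω x (A (0, 1)) (A (1, 0)), cross]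
  ring

/-- A diffeomorphism between an open subset of `M` and an open subset of `ℝ × ℝ`. -/
structure IsCoord (e : OpenPartialHomeomorph M (ℝ × ℝ)) : Prop where
  contMDiffOn : ContMDiffOn (𝓡 2) 𝓘(ℝ, ℝ × ℝ) ∞ e e.source
  contMDiffOn_symm : ContMDiffOn 𝓘(ℝ, ℝ × ℝ) (𝓡 2) ∞ e.symm e.target

/-- The absolute value of the coefficient of `Ω` in the coordinates `e`. -/
noncomputable def coordDensity (e : OpenPartialHomeomorph M (ℝ × ℝ)) (z : ℝ × ℝ) : ℝ :=
  |Ω.form (e.symm z) (mfderiv 𝓘(ℝ, ℝ × ℝ) (𝓡 2) e.symm z ((1 : ℝ), (0 : ℝ)))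
    (mfderiv 𝓘(ℝ, ℝ × ℝ) (𝓡 2) e.symm z ((0 : ℝ), (1 : ℝ)))|

theorem abs_form_mfderiv_symm (e : OpenPartialHomeomorph M (ℝ × ℝ)) (z v w : ℝ × ℝ) :
    |Ω.form (e.symm z) (mfderiv 𝓘(ℝ, ℝ × ℝ) (𝓡 2) e.symm z v)
      (mfderiv 𝓘(ℝ, ℝ × ℝ) (𝓡 2) e.symm z w)| = |cross v w| * coordDensity Ω e z := by
  rw [coordDensity, ← abs_mul]
  exact congrArg _ (form_apply_linear Ω (mfderiv 𝓘(ℝ, ℝ × ℝ) (𝓡 2) e.symm z) v w)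

variable {e : OpenPartialHomeomorph M (ℝ × ℝ)}

/-- A smooth function on an open set that vanishes off a compact subset of it extends by zero
to a smooth function on the plane. -/
theorem contDiff_indicator {t : Set (ℝ × ℝ)} (ht : IsOpen t) {F : ℝ × ℝ → ℝ}
    {K : Set (ℝ × ℝ)} (hK : IsCompact K) (hKt : K ⊆ t) (hF : ContDiffOn ℝ ∞ F t)
    (h0 : ∀ z ∈ t, z ∉ K → F z = 0) : ContDiff ℝ ∞ (t.indicator F) := by
  rw [contDiff_iff_contDiffAt]
  intro z
  by_cases hz : z ∈ t
  · exact (hF.contDiffAt (ht.mem_nhds hz)).congr_of_eventuallyEq <|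
      Filter.eventually_of_mem (ht.mem_nhds hz) fun y hy ↦ indicator_of_mem hy _
  · refine (contDiffAt_const (c := (0 : ℝ))).congr_of_eventuallyEq <|
      Filter.eventually_of_mem (hK.isClosed.isOpen_compl.mem_nhds fun h ↦ hz (hKt h))
        fun y hy ↦ ?_
    by_cases hyt : y ∈ t
    · rw [indicator_of_mem hyt, h0 y hyt hy]
    · exact indicator_of_notMem hyt _

namespace IsCoord

variable (he : IsCoord e)
include he

theorem mdifferentiable : e.MDifferentiable (𝓡 2) 𝓘(ℝ, ℝ × ℝ) :=
  ⟨he.contMDiffOn.mdifferentiableOn (by simp), he.contMDiffOn_symm.mdifferentiableOn (by simp)⟩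

theorem coordDensity_pos {z : ℝ × ℝ} (hz : z ∈ e.target) : 0 < coordDensity Ω e z := by
  refine (abs_nonneg _).lt_of_ne' fun h ↦ ?_
  have hs := he.mdifferentiable.symm.mfderiv_surjective hz
  have h0 (v w : ℝ × ℝ) : Ω.form (e.symm z) (mfderiv 𝓘(ℝ, ℝ × ℝ) (𝓡 2) e.symm z v)
      (mfderiv 𝓘(ℝ, ℝ × ℝ) (𝓡 2) e.symm z w) = 0 := by
    rw [← abs_eq_zero, abs_form_mfderiv_symm Ω e z v w, coordDensity, h, mul_zero]
  have h1 : mfderiv 𝓘(ℝ, ℝ × ℝ) (𝓡 2) e.symm z ((1 : ℝ), (0 : ℝ)) = 0 := by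
    refine Ω.nondegenerate _ _ fun w ↦ ?_
    obtain ⟨u, rfl⟩ := hs w
    exact h0 _ _
  have h2 := he.mdifferentiable.symm.mfderiv_injective hz (h1.trans (map_zero _).symm)
  exact one_ne_zero (congrArg Prod.fst h2 : (1 : ℝ) = 0)

theorem contDiffOn_coordDensity : ContDiffOn ℝ ∞ (coordDensity Ω e) e.target := by
  have hfield (v : ℝ × ℝ) : ContMDiffOn 𝓘(ℝ, ℝ × ℝ) (𝓡 2).tangent ∞
      (fun z ↦ (Bundle.TotalSpace.mk' Plane (e.symm z)
        (mfderiv 𝓘(ℝ, ℝ × ℝ) (𝓡 2) e.symm z v) : TangentBundle (𝓡 2) M)) e.target := by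
    have h1 := he.contMDiffOn_symm.contMDiffOn_tangentMapWithin (m := ∞) (by simp)
      e.open_target.uniqueMDiffOn
    have h2 : ContMDiff 𝓘(ℝ, ℝ × ℝ) (𝓘(ℝ, ℝ × ℝ)).tangent ∞
        (fun z ↦ (⟨z, v⟩ : TangentBundle 𝓘(ℝ, ℝ × ℝ) (ℝ × ℝ))) :=
      contMDiff_vectorSpace_iff_contDiff.2 contDiff_const
    refine (h1.comp (t := Bundle.TotalSpace.proj ⁻¹' e.target) h2.contMDiffOn
      (fun z hz ↦ hz)).congr fun z hz ↦ ?_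
    simp only [Function.comp, tangentMapWithin]
    rw [mfderivWithin_of_isOpen e.open_target hz]
  have hform := (Ω.contMDiff.comp_contMDiffOn he.contMDiffOn_symm)
  have h := hform.clm_bundle_apply₂ (E₃ := Bundle.Trivial M ℝ) (F₃ := ℝ)
    (hfield ((1 : ℝ), (0 : ℝ))) (hfield ((0 : ℝ), (1 : ℝ)))
  have h1 : ContDiffOn ℝ ∞ (fun z ↦ Ω.form (e.symm z)
      (mfderiv 𝓘(ℝ, ℝ × ℝ) (𝓡 2) e.symm z ((1 : ℝ), (0 : ℝ)))
      (mfderiv 𝓘(ℝ, ℝ × ℝ) (𝓡 2) e.symm z ((0 : ℝ), (1 : ℝ)))) e.target := fun z hz ↦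
    (Bundle.contMDiffWithinAt_totalSpace.1 (h z hz)).2.contDiffWithinAt
  exact h1.abs fun z hz ↦ abs_pos.1 (he.coordDensity_pos Ω hz)

/-- A smooth function in the coordinates `e` that vanishes off a compact subset of the target
extends by zero to a smooth function on the surface. -/
theorem contMDiff_indicator [T2Space M] {F : ℝ × ℝ → ℝ} {K : Set (ℝ × ℝ)} (hK : IsCompact K)
    (hKt : K ⊆ e.target) (hF : ContDiffOn ℝ ∞ F e.target) (h0 : ∀ z ∈ e.target, z ∉ K → F z = 0) :
    ContMDiff (𝓡 2) 𝓘(ℝ, ℝ) ∞ (e.source.indicator (F ∘ e)) := by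
  intro x
  by_cases hx : x ∈ e.source
  · have h1 : ContMDiffAt (𝓡 2) 𝓘(ℝ, ℝ) ∞ (F ∘ e) x :=
      ((hF.contMDiffOn.comp he.contMDiffOn e.mapsTo) x hx).contMDiffAt (e.open_source.mem_nhds hx)
    exact h1.congr_of_eventuallyEq <| Filter.eventually_of_mem (e.open_source.mem_nhds hx)
      fun y hy ↦ indicator_of_mem hy _
  · have hcl : IsClosed (e.symm '' K) :=
      (hK.image_of_continuousOn (e.continuousOn_symm.mono hKt)).isClosed
    have hx' : x ∈ (e.symm '' K)ᶜ := by
      rintro ⟨z, hz, rfl⟩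
      exact hx (e.map_target (hKt hz))
    refine (contMDiffAt_const (c := (0 : ℝ))).congr_of_eventuallyEq <|
      Filter.eventually_of_mem (hcl.isOpen_compl.mem_nhds hx') fun y hy ↦ ?_
    by_cases hys : y ∈ e.source
    · rw [indicator_of_mem hys, Function.comp_apply, h0 _ (e.map_source hys)]
      exact fun h ↦ hy ⟨e y, h, e.left_inv hys⟩
    · exact indicator_of_notMem hys _

/-- The map of the surface that is `Φ` in the coordinates `e` and the identity elsewhere. -/
theorem contMDiff_piecewise [T2Space M] {Φ : ℝ × ℝ → ℝ × ℝ} (hΦ : ContDiff ℝ ∞ Φ)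
    (hmaps : MapsTo Φ e.target e.target) {K : Set (ℝ × ℝ)} (hK : IsCompact K)
    (hKt : K ⊆ e.target) (h0 : ∀ z, z ∉ K → Φ z = z) [DecidablePred (· ∈ e.source)] :
    ContMDiff (𝓡 2) (𝓡 2) ∞ (e.source.piecewise (e.symm ∘ Φ ∘ e) id) := by
  intro x
  by_cases hx : x ∈ e.source
  · have h1 : ContMDiffOn (𝓡 2) (𝓡 2) ∞ (e.symm ∘ Φ ∘ e) e.source :=
      he.contMDiffOn_symm.comp (hΦ.contMDiff.comp_contMDiffOn he.contMDiffOn)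
        fun y hy ↦ hmaps (e.map_source hy)
    exact ((h1 x hx).contMDiffAt (e.open_source.mem_nhds hx)).congr_of_eventuallyEq <|
      Filter.eventually_of_mem (e.open_source.mem_nhds hx)
        fun y hy ↦ piecewise_eq_of_mem _ _ _ hy
  · have hcl : IsClosed (e.symm '' K) :=
      (hK.image_of_continuousOn (e.continuousOn_symm.mono hKt)).isClosed
    have hx' : x ∈ (e.symm '' K)ᶜ := by
      rintro ⟨z, hz, rfl⟩
      exact hx (e.map_target (hKt hz))
    refine contMDiffAt_id.congr_of_eventuallyEq <|
      Filter.eventually_of_mem (hcl.isOpen_compl.mem_nhds hx') fun y hy ↦ ?_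
    by_cases hys : y ∈ e.source
    · rw [piecewise_eq_of_mem _ _ _ hys, Function.comp_apply, Function.comp_apply, h0,
        e.left_inv hys, id]
      exact fun h ↦ hy ⟨e y, h, e.left_inv hys⟩
    · exact piecewise_eq_of_notMem _ _ _ hys

end IsCoord

/-- `φ` carries the density `ρ₀` to the density `ρ₁`: `φ^*(ρ₁ |Ω|) = ρ₀ |Ω|`. -/
def Transports (φ : M → M) (ρ₀ ρ₁ : M → ℝ) : Prop :=
  ∀ (x : M) (v w : TangentSpace (𝓡 2) x),
    ρ₁ (φ x) * |Ω.form (φ x) (mfderiv (𝓡 2) (𝓡 2) φ x v) (mfderiv (𝓡 2) (𝓡 2) φ x w)| =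
      ρ₀ x * |Ω.form x v w|

variable {Ω} in
/-- Density transports compose, so that a diffeomorphism between two densities may be built
through intermediate densities. -/
theorem Transports.trans {φ ψ : M ≃ₘ^∞⟮𝓡 2, 𝓡 2⟯ M} {ρ₀ ρ₁ ρ₂ : M → ℝ}
    (h : Transports Ω φ ρ₀ ρ₁) (h' : Transports Ω ψ ρ₁ ρ₂) :
    Transports Ω (φ.trans ψ) ρ₀ ρ₂ := by
  intro x v w
  rw [Diffeomorph.coe_trans, mfderiv_comp x (ψ.mdifferentiable (by simp) _)
    (φ.mdifferentiable (by simp) _)]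
  exact (h' (φ x) _ _).trans (h x v w)

theorem Transports.refl (ρ : M → ℝ) :
    Transports Ω (Diffeomorph.refl (𝓡 2) M ∞) ρ ρ := by
  intro x v w
  rw [Diffeomorph.coe_refl, mfderiv_id]
  rfl

/-- The function `h / |Ω|` in the coordinates `e`, extended by zero: the density with respect to
`Ω` of the measure `h dz` on the target of `e`. -/
noncomputable def coordPush (e : OpenPartialHomeomorph M (ℝ × ℝ)) (h : ℝ × ℝ → ℝ) : M → ℝ :=
  e.source.indicator ((fun z ↦ h z / coordDensity Ω e z) ∘ e)

theorem IsCoord.contMDiff_coordPush [T2Space M] (he : IsCoord e) {h : ℝ × ℝ → ℝ}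
    (hh : ContDiff ℝ ∞ h) (hc : HasCompactSupport h) (hs : tsupport h ⊆ e.target) :
    ContMDiff (𝓡 2) 𝓘(ℝ, ℝ) ∞ (coordPush Ω e h) :=
  he.contMDiff_indicator hc hs
    (hh.contDiffOn.div (he.contDiffOn_coordDensity Ω) fun _ hz ↦ (he.coordDensity_pos Ω hz).ne')
    fun z _ hz ↦ by rw [image_eq_zero_of_notMem_tsupport hz, zero_div]

end Coordinates

/-! ### Elementary moves: fibrewise transport in coordinates -/

section ElementaryMove

variable {M : Type*} [TopologicalSpace M] [T2Space M] [ChartedSpace Plane M]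
  [IsManifold (𝓡 2) ∞ M] (Ω : SymplecticForm M) {e : OpenPartialHomeomorph M (ℝ × ℝ)}

/-- A diffeomorphism of the plane supported in a compact subset of the target of `e` extends by
the identity to a diffeomorphism of the surface. -/
theorem IsCoord.exists_diffeomorph_extension (he : IsCoord e)
    (Φ : (ℝ × ℝ) ≃ₘ^∞⟮𝓘(ℝ, ℝ × ℝ), 𝓘(ℝ, ℝ × ℝ)⟯ (ℝ × ℝ)) {K : Set (ℝ × ℝ)} (hK : IsCompact K)
    (hKt : K ⊆ e.target) (h0 : ∀ z, z ∉ K → Φ z = z) :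
    ∃ φ : M ≃ₘ^∞⟮𝓡 2, 𝓡 2⟯ M, (∀ x ∈ e.source, φ x = e.symm (Φ (e x))) ∧
      ∀ x, x ∉ e.symm '' K → φ x = x := by
  classical
  have h0' : ∀ z, z ∉ K → Φ.symm z = z := fun z hz ↦ by
    conv_lhs => rw [← h0 z hz]
    exact Φ.symm_apply_apply z
  have hmaps {Ψ : (ℝ × ℝ) ≃ₘ^∞⟮𝓘(ℝ, ℝ × ℝ), 𝓘(ℝ, ℝ × ℝ)⟯ (ℝ × ℝ)}
      (hΨ : ∀ z, z ∉ K → Ψ z = z) : MapsTo Ψ e.target e.target := fun z hz ↦ by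
    by_cases h : Ψ z ∈ K
    · exact hKt h
    · have h1 : Ψ z = z := Ψ.injective (hΨ _ h)
      rwa [h1]
  have hinv {Ψ Ψ' : (ℝ × ℝ) ≃ₘ^∞⟮𝓘(ℝ, ℝ × ℝ), 𝓘(ℝ, ℝ × ℝ)⟯ (ℝ × ℝ)}
      (hΨ : ∀ z, z ∉ K → Ψ z = z) (h : ∀ z, Ψ' (Ψ z) = z) : Function.LeftInverse
        (e.source.piecewise (e.symm ∘ Ψ' ∘ e) id) (e.source.piecewise (e.symm ∘ Ψ ∘ e) id) := by
    intro x
    by_cases hx : x ∈ e.source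
    · have h1 := hmaps hΨ (e.map_source hx)
      rw [piecewise_eq_of_mem _ _ _ hx]
      refine (piecewise_eq_of_mem _ _ _ (e.map_target h1)).trans ?_
      simp only [Function.comp_apply]
      rw [e.right_inv h1, h, e.left_inv hx]
    · rw [piecewise_eq_of_notMem _ _ _ hx]
      exact piecewise_eq_of_notMem _ _ _ hx
  refine ⟨⟨⟨_, _, hinv h0 Φ.symm_apply_apply, hinv h0' Φ.apply_symm_apply⟩,
    he.contMDiff_piecewise Φ.contDiff (hmaps h0) hK hKt h0,
    he.contMDiff_piecewise Φ.symm.contDiff (hmaps h0') hK hKt h0'⟩, fun x hx ↦ ?_, fun x hx ↦ ?_⟩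
  · exact piecewise_eq_of_mem _ _ _ hx
  · by_cases hxs : x ∈ e.source
    · have h1 : e x ∉ K := fun h ↦ hx ⟨e x, h, e.left_inv hxs⟩
      refine (piecewise_eq_of_mem _ _ _ hxs).trans ?_
      simp only [Function.comp_apply]
      rw [h0 _ h1, e.left_inv hxs]
    · exact piecewise_eq_of_notMem _ _ _ hxs

/-- Smooth densities whose difference is, in some coordinates, the vertical derivative of a
compactly supported function are exchanged by a diffeomorphism. -/
theorem IsCoord.exists_transports_add_coordPush (he : IsCoord e) {b : ℝ × ℝ → ℝ}
    (hb : ContDiff ℝ ∞ b) (hbc : HasCompactSupport b) (hbt : tsupport b ⊆ e.target) {σ : M → ℝ}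
    (hσ : ContMDiff (𝓡 2) 𝓘(ℝ, ℝ) ∞ σ) (hpos : ∀ x, 0 < σ x)
    (hpos' : ∀ x, 0 < σ x + coordPush Ω e (fun z ↦ fderiv ℝ b z (0, 1)) x) :
    ∃ φ : M ≃ₘ^∞⟮𝓡 2, 𝓡 2⟯ M,
      Transports Ω φ σ (fun x ↦ σ x + coordPush Ω e (fun z ↦ fderiv ℝ b z (0, 1)) x) := by
  set K := tsupport b with hK
  set w := coordDensity Ω e with hw
  have hbK : ∀ z, z ∉ K → fderiv ℝ b z = 0 := fun z hz ↦
    image_eq_zero_of_notMem_tsupport fun h ↦ hz (tsupport_fderiv_subset ℝ h)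
  have hpush : ∀ z ∈ e.target, coordPush Ω e (fun z ↦ fderiv ℝ b z (0, 1)) (e.symm z) * w z =
      fderiv ℝ b z (0, 1) := fun z hz ↦ by
    rw [coordPush, indicator_of_mem (e.map_target hz), Function.comp_apply, e.right_inv hz]
    exact div_mul_cancel₀ _ (he.coordDensity_pos Ω hz).ne'
  -- a cutoff function, needed since the density is only defined on the target of `e`
  obtain ⟨V, hVo, hKV, hVt, hVc⟩ := exists_open_between_and_isCompact_closure hbc e.open_target hbt
  obtain ⟨χ, hχ1, hχ0, hχ⟩ := exists_contMDiffMap_zero_one_of_isClosed (n := ⊤) 𝓘(ℝ, ℝ × ℝ)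
    (s := Vᶜ) (t := K) hVo.isClosed_compl (isClosed_tsupport b)
    (disjoint_left.2 fun z hz hz' ↦ hz (hKV hz'))
  have hχs : ContDiff ℝ ∞ χ := χ.contMDiff.contDiff
  set s₀ : ℝ × ℝ → ℝ := fun z ↦
    1 + e.target.indicator (fun z ↦ χ z * (σ (e.symm z) * w z - 1)) z with hs₀
  have hs₀s : ContDiff ℝ ∞ (e.target.indicator (fun z ↦ χ z * (σ (e.symm z) * w z - 1))) := by
    refine contDiff_indicator e.open_target hVc hVt ?_ fun z _ hz ↦ ?_
    · have h1 : ContDiffOn ℝ ∞ (fun z ↦ σ (e.symm z)) e.target :=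
        (hσ.comp_contMDiffOn he.contMDiffOn_symm).contDiffOn
      exact hχs.contDiffOn.mul ((h1.mul (he.contDiffOn_coordDensity Ω)).sub contDiffOn_const)
    · rw [show χ z = 0 from hχ1 fun h ↦ hz (subset_closure h), zero_mul]
  have hs₀c : HasCompactSupport fun z ↦ s₀ z - 1 := by
    refine HasCompactSupport.intro hVc fun z hz ↦ ?_
    simp only [hs₀, add_sub_cancel_left]
    refine indicator_apply_eq_zero.2 fun _ ↦ ?_
    rw [show χ z = 0 from hχ1 fun h ↦ hz (subset_closure h), zero_mul]
  have hs₀K : ∀ z ∈ K, s₀ z = σ (e.symm z) * w z := fun z hz ↦ by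
    simp only [hs₀]
    rw [indicator_of_mem (hbt hz), show χ z = 1 from hχ0 hz]
    ring
  have hs₀pos : ∀ z, 0 < s₀ z := fun z ↦ by
    simp only [hs₀]
    by_cases hz : z ∈ e.target
    · rw [indicator_of_mem hz]
      have h1 : 0 < σ (e.symm z) * w z := mul_pos (hpos _) (he.coordDensity_pos Ω hz)
      have h2 := hχ z
      nlinarith [h2.1, h2.2, mul_nonneg h2.1 h1.le]
    · rw [indicator_of_notMem hz]
      norm_num
  have hsum : ∀ z ∈ K, s₀ z + fderiv ℝ b z (0, 1) =
      (σ (e.symm z) + coordPush Ω e (fun z ↦ fderiv ℝ b z (0, 1)) (e.symm z)) * w z :=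
    fun z hz ↦ by rw [add_mul, hpush z (hbt hz), hs₀K z hz]
  have hs₁pos : ∀ z, 0 < s₀ z + fderiv ℝ b z (0, 1) := fun z ↦ by
    by_cases hz : z ∈ K
    · rw [hsum z hz]
      exact mul_pos (hpos' _) (he.coordDensity_pos Ω (hbt hz))
    · rw [hbK z hz]
      simpa using hs₀pos z
  obtain ⟨Φ, hΦ0, hΦ⟩ := exists_fiber_transport (σ := s₀) (contDiff_const.add hs₀s) hs₀c hb hbc
    hs₀pos hs₁pos
  have hΦK : ∀ z, z ∉ K → Φ z = z := fun z hz ↦ hΦ0 z (image_eq_zero_of_notMem_tsupport hz)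
  have hΦmaps : ∀ z ∈ K, Φ z ∈ K := fun z hz ↦ by
    by_contra h
    have h1 : Φ z = z := Φ.injective (hΦK _ h)
    exact h (h1.symm ▸ hz)
  obtain ⟨φ, hφ, hφK⟩ := he.exists_diffeomorph_extension Φ hbc hbt hΦK
  refine ⟨φ, fun x u v ↦ ?_⟩
  by_cases hx : x ∈ e.symm '' K
  · obtain ⟨z, hz, rfl⟩ := hx
    have hzt := hbt hz
    have hxs := e.map_target hzt
    have hφx : φ (e.symm z) = e.symm (Φ z) := by rw [hφ _ hxs, e.right_inv hzt]
    have hsurj : ∀ t : TangentSpace (𝓡 2) (e.symm z), ∃ u : ℝ × ℝ,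
        mfderiv 𝓘(ℝ, ℝ × ℝ) (𝓡 2) e.symm z u = t :=
      he.mdifferentiable.symm.mfderiv_surjective hzt
    obtain ⟨u, rfl⟩ := hsurj u
    obtain ⟨v, rfl⟩ := hsurj v
    have hd : ∀ u : ℝ × ℝ, mfderiv (𝓡 2) (𝓡 2) φ (e.symm z)
        (mfderiv 𝓘(ℝ, ℝ × ℝ) (𝓡 2) e.symm z u) =
        mfderiv 𝓘(ℝ, ℝ × ℝ) (𝓡 2) e.symm (Φ z) (fderiv ℝ Φ z u) := by
      intro u
      have h1 : (φ ∘ e.symm) =ᶠ[𝓝 z] (e.symm ∘ Φ) :=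
        Filter.eventually_of_mem (e.open_target.mem_nhds hzt) fun y hy ↦ by
          rw [Function.comp_apply, Function.comp_apply, hφ _ (e.map_target hy), e.right_inv hy]
      have h2 := h1.mfderiv_eq (I := 𝓘(ℝ, ℝ × ℝ)) (I' := 𝓡 2)
      rw [mfderiv_comp z (φ.mdifferentiable (by simp) _)
        (he.mdifferentiable.mdifferentiableAt_symm hzt),
        mfderiv_comp z (he.mdifferentiable.mdifferentiableAt_symm (hbt (hΦmaps z hz)))
        (Φ.mdifferentiable (by simp) _), mfderiv_eq_fderiv] at h2
      exact DFunLike.congr_fun h2 u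
    -- `Ω.form` at propositionally equal points, the tangent spaces being definitionally `Plane`
    have aux : ∀ y : M, y = e.symm (Φ z) → ∀ a b : Plane,
        |Ω.form y a b| = |Ω.form (e.symm (Φ z)) a b| := by
      rintro _ rfl a b
      rfl
    have h4 := (aux _ hφx _ _).trans <|
      congrArg₂ (fun a b : Plane ↦ |Ω.form (e.symm (Φ z)) a b|) (hd u) (hd v)
    have h3 := congrArg abs (hΦ z u v)
    rw [hsum _ (hΦmaps z hz), hs₀K z hz, abs_mul _ (cross _ _), abs_mul _ (cross _ _),
      abs_of_pos (mul_pos (hpos _) (he.coordDensity_pos Ω hzt)),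
      abs_of_pos (mul_pos (hpos' _) (he.coordDensity_pos Ω (hbt (hΦmaps z hz))))] at h3
    calc _ = (σ (e.symm (Φ z)) + coordPush Ω e (fun z ↦ fderiv ℝ b z (0, 1)) (e.symm (Φ z))) *
        (|cross (fderiv ℝ Φ z u) (fderiv ℝ Φ z v)| * w (Φ z)) :=
            congrArg₂ (· * ·) (by rw [hφx]) (h4.trans (abs_form_mfderiv_symm Ω e (Φ z) _ _))
      _ = σ (e.symm z) * (|cross u v| * w z) := by linarith
      _ = _ := congrArg _ (abs_form_mfderiv_symm Ω e z u v).symm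
  · have hcl : IsClosed (e.symm '' K) :=
      (hbc.isCompact.image_of_continuousOn (e.continuousOn_symm.mono hbt)).isClosed
    have h1 : (φ : M → M) =ᶠ[𝓝 x] id :=
      Filter.eventually_of_mem (hcl.isOpen_compl.mem_nhds hx) fun y hy ↦ hφK y hy
    have h2 : coordPush Ω e (fun z ↦ fderiv ℝ b z (0, 1)) x = 0 := by
      refine indicator_apply_eq_zero.2 fun hxs ↦ ?_
      have h3 : e x ∉ K := fun h ↦ hx ⟨e x, h, e.left_inv hxs⟩
      simp [hbK _ h3]
    rw [h1.mfderiv_eq, hφK x hx, mfderiv_id]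
    beta_reduce
    rw [h2, add_zero]
    rfl

end ElementaryMove

/-! ### The area measure -/

section AreaMeasure

theorem ContinuousOn.measurableSet_source_inter_preimage {α β : Type*} [TopologicalSpace α]
    [MeasurableSpace α] [BorelSpace α] [TopologicalSpace β] [MeasurableSpace β] [BorelSpace β]
    {f : α → β} {t : Set α} (hf : ContinuousOn f t) (ht : MeasurableSet t) {A : Set β}
    (hA : MeasurableSet A) : MeasurableSet (t ∩ f ⁻¹' A) := by
  have h := ht.subtype_image ((continuousOn_iff_continuous_domRestrict.1 hf).measurable hA)
  convert! h using 1
  ext x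
  simp [and_comm]

variable {M : Type*} [TopologicalSpace M] [ChartedSpace Plane M] [IsManifold (𝓡 2) ∞ M]
  (Ω : SymplecticForm M)

/-- Precomposing with an endomorphism of the plane multiplies the area form by the determinant;
this feeds the Jacobian of the change of variables formula. -/
theorem abs_form_comp_det {x : M} (A : Plane →L[ℝ] TangentSpace (𝓡 2) x) (L : Plane →L[ℝ] Plane) :
    |Ω.form x (A (L (EuclideanSpace.single (0 : Fin 2) (1 : ℝ))))
        (A (L (EuclideanSpace.single (1 : Fin 2) (1 : ℝ))))| =
      |L.det| * |Ω.form x (A (EuclideanSpace.single (0 : Fin 2) (1 : ℝ)))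
        (A (EuclideanSpace.single (1 : Fin 2) (1 : ℝ)))| := by
  set e₀ : Plane := EuclideanSpace.single (0 : Fin 2) (1 : ℝ) with he₀
  set e₁ : Plane := EuclideanSpace.single (1 : Fin 2) (1 : ℝ) with he₁
  have hdet : L.det = (L e₀) 0 * (L e₁) 1 - (L e₁) 0 * (L e₀) 1 := by
    rw [ContinuousLinearMap.det,
      ← LinearMap.det_toMatrix (EuclideanSpace.basisFun (Fin 2) ℝ).toBasis, Matrix.det_fin_two]
    simp [LinearMap.toMatrix_apply, he₀, he₁]
  have h (u : Plane) : A u = u 0 • A e₀ + u 1 • A e₁ := by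
    rw [← map_smul, ← map_smul, ← map_add]
    congr 1
    ext i
    fin_cases i <;> simp [he₀, he₁]
  rw [← abs_mul, hdet, h (L e₀), h (L e₁)]
  simp only [map_add, map_smul, add_apply, smul_apply,
    Ω.alternating, smul_eq_mul, form_swap Ω x (A e₁) (A e₀)]
  congr 1
  ring

variable {Ω} in
/-- The change of variables formula for a density transport, in charts. -/
theorem Transports.setLIntegral_chartDensity [MeasurableSpace M] [BorelSpace M]
    {φ : M ≃ₘ^∞⟮𝓡 2, 𝓡 2⟯ M} {ρ₀ ρ₁ : M → ℝ} (h : Transports Ω φ ρ₀ ρ₁)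
    {e₀ e₁ : OpenPartialHomeomorph M Plane} (he₀ : e₀ ∈ atlas Plane M) (he₁ : e₁ ∈ atlas Plane M)
    {A : Set M} (hA : MeasurableSet A) (hA₁ : A ⊆ e₁.source) (hA₀ : φ ⁻¹' A ⊆ e₀.source) :
    ∫⁻ y in e₁.target ∩ e₁.symm ⁻¹' A,
        ENNReal.ofReal (ρ₁ (e₁.symm y) * chartDensity Ω e₁ y) =
      ∫⁻ z in e₀.target ∩ e₀.symm ⁻¹' (φ ⁻¹' A),
        ENNReal.ofReal (ρ₀ (e₀.symm z) * chartDensity Ω e₀ z) := by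
  have hd₀ := mdifferentiable_of_mem_atlas (I := 𝓡 2) he₀
  have hd₁ := mdifferentiable_of_mem_atlas (I := 𝓡 2) he₁
  set g : Plane → Plane := e₁ ∘ φ ∘ e₀.symm with hg
  set B := e₀.target ∩ e₀.symm ⁻¹' (φ ⁻¹' A) with hB
  have hBm : MeasurableSet B := e₀.continuousOn_symm.measurableSet_source_inter_preimage
    e₀.open_target.measurableSet (φ.continuous.measurable hA)
  have hgd : ∀ z ∈ B, MDifferentiableAt 𝓘(ℝ, Plane) 𝓘(ℝ, Plane) g z := fun z hz ↦
    (hd₁.mdifferentiableAt (hA₁ hz.2)).comp z ((φ.mdifferentiable (by simp) _).comp z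
      (hd₀.mdifferentiableAt_symm hz.1))
  have hinj : InjOn g B := by
    intro z hz z' hz' hzz
    exact e₀.symm.injOn hz.1 hz'.1 (φ.injective (e₁.injOn (hA₁ hz.2) (hA₁ hz'.2) hzz))
  have himage : g '' B = e₁.target ∩ e₁.symm ⁻¹' A := by
    ext y
    constructor
    · rintro ⟨z, hz, rfl⟩
      refine ⟨e₁.map_source (hA₁ hz.2), ?_⟩
      change e₁.symm (e₁ (φ (e₀.symm z))) ∈ A
      rw [e₁.left_inv (hA₁ hz.2)]
      exact hz.2
    · rintro ⟨hy, hyA⟩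
      have h1 : φ (φ.symm (e₁.symm y)) = e₁.symm y := φ.apply_symm_apply _
      have h2 : φ.symm (e₁.symm y) ∈ φ ⁻¹' A := by
        change φ (φ.symm (e₁.symm y)) ∈ A
        rwa [h1]
      refine ⟨e₀ (φ.symm (e₁.symm y)), ⟨e₀.map_source (hA₀ h2), ?_⟩, ?_⟩
      · rw [mem_preimage, e₀.left_inv (hA₀ h2)]
        exact h2
      · simp only [hg, Function.comp_apply]
        rw [e₀.left_inv (hA₀ h2), h1, e₁.right_inv hy]
  rw [← himage, lintegral_image_eq_lintegral_abs_det_fderiv_mul volume hBm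
    (fun z hz ↦ (hgd z hz).differentiableAt.hasFDerivAt.hasFDerivWithinAt) hinj]
  refine setLIntegral_congr_fun hBm fun z hz ↦ ?_
  rw [← ENNReal.ofReal_mul (abs_nonneg _)]
  congr 1
  have hgz : e₁.symm (g z) = φ (e₀.symm z) := e₁.left_inv (hA₁ hz.2)
  -- the derivative of `e₁.symm ∘ g = φ ∘ e₀.symm`
  have hev : e₁.symm ∘ g =ᶠ[𝓝 z] φ ∘ e₀.symm := by
    have h1 : ContinuousAt (φ ∘ e₀.symm) z :=
      φ.continuous.continuousAt.comp (e₀.continuousAt_symm hz.1)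
    filter_upwards [h1 (e₁.open_source.mem_nhds (hA₁ hz.2))] with y hy
    exact e₁.left_inv hy
  have hder : ∀ u : Plane, mfderiv 𝓘(ℝ, Plane) (𝓡 2) e₁.symm (g z) (fderiv ℝ g z u) =
      mfderiv (𝓡 2) (𝓡 2) φ (e₀.symm z) (mfderiv 𝓘(ℝ, Plane) (𝓡 2) e₀.symm z u) := by
    intro u
    have h2 := hev.mfderiv_eq (I := 𝓘(ℝ, Plane)) (I' := 𝓡 2)
    rw [mfderiv_comp z (hd₁.mdifferentiableAt_symm (e₁.map_source (hA₁ hz.2))) (hgd z hz),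
      mfderiv_comp z (φ.mdifferentiable (by simp) _) (hd₀.mdifferentiableAt_symm hz.1),
      mfderiv_eq_fderiv] at h2
    exact DFunLike.congr_fun h2 u
  -- `Ω.form` at propositionally equal points, the tangent spaces being definitionally `Plane`
  have aux : ∀ y : M, y = φ (e₀.symm z) → ∀ a b : Plane,
      |Ω.form y a b| = |Ω.form (φ (e₀.symm z)) a b| := by
    rintro _ rfl a b
    rfl
  have h3 := abs_form_comp_det Ω (mfderiv 𝓘(ℝ, Plane) (𝓡 2) e₁.symm (g z)) (fderiv ℝ g z)
  have h4 := (aux _ hgz _ _).symm.trans h3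
  have h5 := (congrArg₂ (fun a b : Plane ↦ |Ω.form (φ (e₀.symm z)) a b|)
    (hder (EuclideanSpace.single (0 : Fin 2) (1 : ℝ)))
    (hder (EuclideanSpace.single (1 : Fin 2) (1 : ℝ)))).symm.trans h4
  have h6 := h (e₀.symm z)
    (mfderiv 𝓘(ℝ, Plane) (𝓡 2) e₀.symm z (EuclideanSpace.single (0 : Fin 2) (1 : ℝ) : Plane))
    (mfderiv 𝓘(ℝ, Plane) (𝓡 2) e₀.symm z (EuclideanSpace.single (1 : Fin 2) (1 : ℝ) : Plane))
  have h7 : |(fderiv ℝ g z).det| * chartDensity Ω e₁ (g z) = _ := h5.symm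
  calc _ = ρ₁ (e₁.symm (g z)) * (|(fderiv ℝ g z).det| * chartDensity Ω e₁ (g z)) := by ring
    _ = _ := by rw [h7, hgz]; exact h6

end AreaMeasure

section AreaMeasureGluing

variable {M : Type*} [TopologicalSpace M] [ChartedSpace Plane M] [IsManifold (𝓡 2) ∞ M]
  [MeasurableSpace M] [BorelSpace M] (Ω : SymplecticForm M)

theorem chartMeasure_apply (e : OpenPartialHomeomorph M Plane) {A : Set M} (hA : MeasurableSet A) :
    chartMeasure Ω e A =
      ∫⁻ y in e.target ∩ e.symm ⁻¹' A, ENNReal.ofReal (chartDensity Ω e y) := by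
  have hm : AEMeasurable e.symm (volume.restrict e.target) :=
    e.continuousOn_symm.aemeasurable e.open_target.measurableSet
  have hm' : AEMeasurable e.symm ((volume.restrict e.target).withDensity
      fun y ↦ ENNReal.ofReal (chartDensity Ω e y)) :=
    hm.mono_ac (withDensity_absolutelyContinuous _ _)
  have hms := e.continuousOn_symm.measurableSet_source_inter_preimage e.open_target.measurableSet hA
  rw [chartMeasure, Measure.map_apply_of_aemeasurable hm' hA, withDensity_apply',
    Measure.restrict_restrict' e.open_target.measurableSet, inter_comm]

theorem chartMeasure_eq_inter_source (e : OpenPartialHomeomorph M Plane) {A : Set M}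
    (hA : MeasurableSet A) : chartMeasure Ω e A = chartMeasure Ω e (A ∩ e.source) := by
  rw [chartMeasure_apply Ω e hA, chartMeasure_apply Ω e (hA.inter e.open_source.measurableSet)]
  congr 2
  ext y
  simp only [mem_inter_iff, mem_preimage]
  exact ⟨fun h ↦ ⟨h.1, h.2, e.map_target h.1⟩, fun h ↦ ⟨h.1, h.2.1⟩⟩

/-- The area measures of two charts agree on the overlap of their domains. -/
theorem chartMeasure_eq_of_subset {e₀ e₁ : OpenPartialHomeomorph M Plane}
    (he₀ : e₀ ∈ atlas Plane M) (he₁ : e₁ ∈ atlas Plane M) {A : Set M} (hA : MeasurableSet A)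
    (h₀ : A ⊆ e₀.source) (h₁ : A ⊆ e₁.source) : chartMeasure Ω e₁ A = chartMeasure Ω e₀ A := by
  have h := (Transports.refl Ω fun _ ↦ 1).setLIntegral_chartDensity he₀ he₁ hA h₁ h₀
  simp only [one_mul] at h
  rw [chartMeasure_apply Ω e₁ hA, chartMeasure_apply Ω e₀ hA]
  exact h

variable [CompactSpace M]

theorem exists_finset_iUnion_chartAt_source : ∃ t : Finset M,
    ⋃ p : t, (chartAt Plane (p : M)).source = univ := by
  obtain ⟨t, ht⟩ := isCompact_univ.elim_nhds_subcover (fun p : M ↦ (chartAt Plane p).source)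
    fun p _ ↦ (chartAt Plane p).open_source.mem_nhds (mem_chart_source _ p)
  refine ⟨t, univ_subset_iff.1 (ht.2.trans ?_)⟩
  rw [iUnion_subtype]

/-- Two measures on a compact space that agree near every point are equal. -/
theorem measure_ext_of_locally {X : Type*} [TopologicalSpace X] [CompactSpace X]
    [MeasurableSpace X] [BorelSpace X] {μ ν : Measure X}
    (h : ∀ p, ∃ V, IsOpen V ∧ p ∈ V ∧ ∀ A, MeasurableSet A → A ⊆ V → μ A = ν A) : μ = ν := by
  choose V hV hpV hA using h
  obtain ⟨t, ht⟩ := isCompact_univ.elim_nhds_subcover V fun p _ ↦ (hV p).mem_nhds (hpV p)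
  have hu : ⋃ p : t, V p = univ := by
    rw [iUnion_subtype]
    exact univ_subset_iff.1 ht.2
  refine (Measure.ext_iff_of_iUnion_eq_univ hu).2 fun p ↦ Measure.ext fun A hAm ↦ ?_
  rw [Measure.restrict_apply hAm, Measure.restrict_apply hAm]
  exact hA _ _ (hAm.inter (hV _).measurableSet) inter_subset_right

/-- On a chart domain, the area measure is the area measure of the chart. -/
theorem areaMeasure_eq_chartMeasure {e : OpenPartialHomeomorph M Plane} (he : e ∈ atlas Plane M)
    {A : Set M} (hA : MeasurableSet A) (hAe : A ⊆ e.source) :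
    areaMeasure Ω A = chartMeasure Ω e A := by
  classical
  obtain ⟨t, ht⟩ := exists_finset_iUnion_chartAt_source (M := M)
  -- glue finitely many chart measures along a measurable partition
  set n := Fintype.card t
  set c : ℕ → Set M := fun k ↦
    if hk : k < n then (chartAt Plane (((Fintype.equivFin t).symm ⟨k, hk⟩ : t) : M)).source else ∅
    with hc
  have hcm : ∀ k, MeasurableSet (c k) := fun k ↦ by
    simp only [hc]
    split_ifs
    · exact (chartAt Plane _).open_source.measurableSet
    · exact MeasurableSet.empty
  have hcu : ⋃ k, c k = univ := by
    refine eq_univ_of_forall fun x ↦ ?_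
    obtain ⟨p, hp⟩ := mem_iUnion.1 (ht ▸ mem_univ x : x ∈ ⋃ p : t, (chartAt Plane (p : M)).source)
    refine mem_iUnion.2 ⟨Fintype.equivFin t p, ?_⟩
    simp only [hc, Fin.eta, Equiv.symm_apply_apply]
    rwa [dif_pos (Fin.is_lt _)]
  set m : ℕ → Measure M := fun k ↦
    if hk : k < n then chartMeasure Ω (chartAt Plane (((Fintype.equivFin t).symm ⟨k, hk⟩ : t) : M))
    else 0 with hm
  have hcons : ∀ e' ∈ atlas Plane M, ∀ k, ∀ B, MeasurableSet B → B ⊆ e'.source → B ⊆ c k →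
      m k B = chartMeasure Ω e' B := by
    intro e' he' k B hB hBe hBc
    by_cases hk : k < n
    · simp only [hc, dif_pos hk] at hBc
      simp only [hm, dif_pos hk]
      exact chartMeasure_eq_of_subset Ω he' (chart_mem_atlas _ _) hB hBe hBc
    · simp only [hc, dif_neg hk] at hBc
      rw [subset_empty_iff.1 hBc]
      simp
  set ν : Measure M := Measure.sum fun k ↦ (m k).restrict (disjointed c k) with hν
  have hdm : ∀ k, MeasurableSet (disjointed c k) := MeasurableSet.disjointed hcm
  have hνe : ∀ e' ∈ atlas Plane M, ∀ B, MeasurableSet B → B ⊆ e'.source →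
      ν B = chartMeasure Ω e' B := by
    intro e' he' B hB hBe
    rw [hν, Measure.sum_apply _ hB]
    have h1 : ∀ k, (m k).restrict (disjointed c k) B = chartMeasure Ω e' (B ∩ disjointed c k) :=
      fun k ↦ by
        rw [Measure.restrict_apply hB]
        exact hcons e' he' k _ (hB.inter (hdm k)) (inter_subset_left.trans hBe)
          (inter_subset_right.trans (disjointed_subset c k))
    simp_rw [h1]
    rw [← measure_iUnion (fun i j hij ↦ ((disjoint_disjointed c hij).mono inter_subset_right
      inter_subset_right)) fun k ↦ hB.inter (hdm k), ← inter_iUnion, iUnion_disjointed, hcu,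
      inter_univ]
  refine le_antisymm ?_ ?_
  -- the glued measure `ν` bounds every chart measure, and `areaMeasure` is their supremum
  · rw [← hνe e he A hA hAe]
    refine (iSup₂_le fun e' he' ↦ Measure.le_iff.2 fun B hB ↦ ?_ : areaMeasure Ω ≤ ν) A
    rw [chartMeasure_eq_inter_source Ω e' hB,
      ← hνe e' he' _ (hB.inter e'.open_source.measurableSet) inter_subset_right]
    exact measure_mono inter_subset_left
  · exact (le_iSup₂ (f := fun (e : OpenPartialHomeomorph M Plane) (_ : e ∈ atlas Plane M) ↦
      chartMeasure Ω e) e he : chartMeasure Ω e ≤ areaMeasure Ω) A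

theorem areaMeasure_restrict_source {e : OpenPartialHomeomorph M Plane} (he : e ∈ atlas Plane M) :
    (areaMeasure Ω).restrict e.source = chartMeasure Ω e := by
  refine Measure.ext fun A hA ↦ ?_
  rw [Measure.restrict_apply hA, chartMeasure_eq_inter_source Ω e hA]
  exact areaMeasure_eq_chartMeasure Ω he (hA.inter e.open_source.measurableSet) inter_subset_right

end AreaMeasureGluing

/-! ### Regularity of the area measure and integration in coordinates -/

section ChartCoordinates

/-- The plane as a product. -/
noncomputable def planeEquiv : Plane ≃L[ℝ] ℝ × ℝ :=
  (EuclideanSpace.equiv (Fin 2) ℝ).trans (ContinuousLinearEquiv.finTwoArrow ℝ ℝ)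

theorem measurePreserving_planeEquiv : MeasurePreserving planeEquiv :=
  (volume_preserving_finTwoArrow ℝ).comp
    (EuclideanSpace.volume_preserving_symm_measurableEquiv_toLp (Fin 2))

theorem planeEquiv_single_zero :
    planeEquiv (EuclideanSpace.single (0 : Fin 2) (1 : ℝ)) = (1, 0) := by
  ext <;> simp [planeEquiv]

theorem planeEquiv_single_one :
    planeEquiv (EuclideanSpace.single (1 : Fin 2) (1 : ℝ)) = (0, 1) := by
  ext <;> simp [planeEquiv]

variable {M : Type*} [TopologicalSpace M] [ChartedSpace Plane M] [IsManifold (𝓡 2) ∞ M]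
  (Ω : SymplecticForm M)

/-- The preferred chart at `p`, with values in `ℝ × ℝ`. -/
noncomputable def coordAt (p : M) : OpenPartialHomeomorph M (ℝ × ℝ) :=
  (chartAt Plane p).transHomeomorph planeEquiv.toHomeomorph

theorem coordAt_symm_apply (p : M) (z : ℝ × ℝ) :
    (coordAt p).symm z = (chartAt Plane p).symm (planeEquiv.symm z) := rfl

theorem coordAt_target (p : M) :
    (coordAt p).target = planeEquiv.symm ⁻¹' (chartAt Plane p).target := rfl

theorem isCoord_coordAt (p : M) : IsCoord (coordAt p) where
  contMDiffOn := planeEquiv.contDiff.contMDiff.comp_contMDiffOn contMDiffOn_chart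
  contMDiffOn_symm := contMDiffOn_chart_symm.comp planeEquiv.symm.contDiff.contMDiff.contMDiffOn
    fun _ hz ↦ hz

/-- The density of the area measure in a chart is the coefficient of `Ω` in the corresponding
`ℝ × ℝ`-valued coordinates, and hence smooth and positive. -/
theorem chartDensity_chartAt (p : M) {y : Plane} (hy : y ∈ (chartAt Plane p).target) :
    chartDensity Ω (chartAt Plane p) y = coordDensity Ω (coordAt p) (planeEquiv y) := by
  have hev : ((chartAt Plane p).symm : Plane → M) = (coordAt p).symm ∘ planeEquiv := by
    funext u
    simp [coordAt_symm_apply]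
  have hy' : planeEquiv y ∈ (coordAt p).target := by
    simpa [coordAt_target] using hy
  have h1 (u : Plane) : mfderiv (𝓡 2) (𝓡 2) (chartAt Plane p).symm y u =
      mfderiv 𝓘(ℝ, ℝ × ℝ) (𝓡 2) (coordAt p).symm (planeEquiv y) (planeEquiv u) := by
    have h2 : mfderiv (𝓡 2) (𝓡 2) (chartAt Plane p).symm y =
        mfderiv (𝓡 2) (𝓡 2) ((coordAt p).symm ∘ planeEquiv) y := by rw [hev]
    rw [mfderiv_comp (I' := 𝓘(ℝ, ℝ × ℝ)) y
      ((isCoord_coordAt p).mdifferentiable.mdifferentiableAt_symm hy')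
      planeEquiv.differentiableAt.mdifferentiableAt, mfderiv_eq_fderiv,
      ContinuousLinearEquiv.fderiv] at h2
    exact DFunLike.congr_fun h2 u
  rw [chartDensity, coordDensity]
  refine (congrArg₂ (fun a b : Plane ↦ |Ω.form ((chartAt Plane p).symm y) a b|)
    (h1 (EuclideanSpace.single (0 : Fin 2) (1 : ℝ)))
    (h1 (EuclideanSpace.single (1 : Fin 2) (1 : ℝ)))).trans ?_
  rw [planeEquiv_single_zero, planeEquiv_single_one]
  -- `Ω.form` at propositionally equal points, the tangent spaces being definitionally `Plane`
  have aux : ∀ x x' : M, x = x' → ∀ a b : Plane, |Ω.form x a b| = |Ω.form x' a b| := by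
    rintro _ _ rfl a b
    rfl
  exact aux _ _ (congrFun hev y) _ _

theorem continuousOn_chartDensity (p : M) :
    ContinuousOn (chartDensity Ω (chartAt Plane p)) (chartAt Plane p).target := by
  refine ContinuousOn.congr (f := coordDensity Ω (coordAt p) ∘ planeEquiv) ?_
    fun y hy ↦ chartDensity_chartAt Ω p hy
  refine ((isCoord_coordAt p).contDiffOn_coordDensity Ω).continuousOn.comp
    planeEquiv.continuous.continuousOn fun y hy ↦ ?_
  simpa [coordAt_target] using hy

theorem chartDensity_pos (p : M) {y : Plane} (hy : y ∈ (chartAt Plane p).target) :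
    0 < chartDensity Ω (chartAt Plane p) y := by
  rw [chartDensity_chartAt Ω p hy]
  exact (isCoord_coordAt p).coordDensity_pos Ω (by simpa [coordAt_target] using hy)

end ChartCoordinates

section AreaMeasureRegularity

variable {M : Type*} [TopologicalSpace M] [ChartedSpace Plane M] [IsManifold (𝓡 2) ∞ M]
  [MeasurableSpace M] [BorelSpace M] [CompactSpace M] (Ω : SymplecticForm M)

theorem areaMeasure_apply_of_subset (p : M) {A : Set M} (hA : MeasurableSet A)
    (hAp : A ⊆ (chartAt Plane p).source) :
    areaMeasure Ω A = ∫⁻ y in (chartAt Plane p).target ∩ (chartAt Plane p).symm ⁻¹' A,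
      ENNReal.ofReal (chartDensity Ω (chartAt Plane p) y) := by
  rw [areaMeasure_eq_chartMeasure Ω (chart_mem_atlas _ p) hA hAp, chartMeasure_apply Ω _ hA]

instance isFiniteMeasure_areaMeasure : IsFiniteMeasure (areaMeasure Ω) := by
  suffices IsLocallyFiniteMeasure (areaMeasure Ω) from inferInstance
  refine ⟨fun p ↦ ?_⟩
  set e := chartAt Plane p
  obtain ⟨C, hC, hCt, hCc⟩ := local_compact_nhds
    (e.open_target.mem_nhds (mem_chart_target Plane p))
  obtain ⟨V, hVC, hV, hpV⟩ := mem_nhds_iff.1 hC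
  refine ⟨e.source ∩ e ⁻¹' V, (e.isOpen_inter_preimage hV).mem_nhds ⟨mem_chart_source _ p, hpV⟩, ?_⟩
  rw [areaMeasure_apply_of_subset Ω p (e.isOpen_inter_preimage hV).measurableSet inter_subset_left]
  have h1 : IntegrableOn (chartDensity Ω e) C :=
    ((continuousOn_chartDensity Ω p).mono hCt).integrableOn_compact hCc
  refine (lintegral_mono_set (fun y hy ↦ hVC ?_ : _ ⊆ C)).trans_lt h1.lintegral_lt_top
  have h2 : e (e.symm y) ∈ V := hy.2.2
  rwa [e.right_inv hy.1] at h2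

instance isOpenPosMeasure_areaMeasure : (areaMeasure Ω).IsOpenPosMeasure := by
  refine ⟨fun W hW ⟨p, hp⟩ h0 ↦ ?_⟩
  set e := chartAt Plane p
  have h1 : areaMeasure Ω (W ∩ e.source) = 0 := measure_mono_null inter_subset_left h0
  rw [areaMeasure_apply_of_subset Ω p (hW.inter e.open_source).measurableSet
    inter_subset_right] at h1
  set V := e.target ∩ e.symm ⁻¹' (W ∩ e.source) with hV
  have hVo : IsOpen V := e.symm.isOpen_inter_preimage (hW.inter e.open_source)
  have hVne : V.Nonempty := ⟨e p, mem_chart_target _ p, by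
    rw [mem_preimage, e.left_inv (mem_chart_source _ p)]
    exact ⟨hp, mem_chart_source _ p⟩⟩
  have hm : AEMeasurable (fun y ↦ ENNReal.ofReal (chartDensity Ω e y)) (volume.restrict V) :=
    (((continuousOn_chartDensity Ω p).mono inter_subset_left).aemeasurable
      hVo.measurableSet).ennreal_ofReal
  rw [lintegral_eq_zero_iff' hm] at h1
  have h2 : ∀ᵐ y ∂volume.restrict V, y ∉ V := by
    filter_upwards [h1] with y hy hyV
    exact (ENNReal.ofReal_pos.2 (chartDensity_pos Ω p hyV.1)).ne' hy
  rw [ae_restrict_iff' hVo.measurableSet] at h2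
  have h3 : volume V = 0 := measure_mono_null (fun y hy ↦ fun h ↦ h hy hy) h2
  exact hVo.measure_ne_zero volume hVne h3

/-- Integrals over a set inside a chart domain, computed in the chart. -/
theorem setLIntegral_areaMeasure (p : M) {A : Set M} (hA : MeasurableSet A)
    (hAp : A ⊆ (chartAt Plane p).source) {ρ : M → ℝ} (hρ : Continuous ρ) (hρ0 : ∀ x, 0 ≤ ρ x) :
    ∫⁻ x in A, ENNReal.ofReal (ρ x) ∂areaMeasure Ω =
      ∫⁻ y in (chartAt Plane p).target ∩ (chartAt Plane p).symm ⁻¹' A, ENNReal.ofReal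
        (ρ ((chartAt Plane p).symm y) * chartDensity Ω (chartAt Plane p) y) := by
  set e := chartAt Plane p
  have hm : AEMeasurable e.symm (volume.restrict e.target) :=
    e.continuousOn_symm.aemeasurable e.open_target.measurableSet
  have hm' : AEMeasurable e.symm ((volume.restrict e.target).withDensity
      fun y ↦ ENNReal.ofReal (chartDensity Ω e y)) :=
    hm.mono_ac (withDensity_absolutelyContinuous _ _)
  have hd : AEMeasurable (fun y ↦ ENNReal.ofReal (chartDensity Ω e y))
      (volume.restrict e.target) :=
    ((continuousOn_chartDensity Ω p).aemeasurable e.open_target.measurableSet).ennreal_ofReal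
  have hms := e.continuousOn_symm.measurableSet_source_inter_preimage e.open_target.measurableSet hA
  have h1 : (areaMeasure Ω).restrict A = (chartMeasure Ω e).restrict A := by
    rw [← areaMeasure_restrict_source Ω (chart_mem_atlas _ p), Measure.restrict_restrict hA,
      inter_eq_left.2 hAp]
  have hρm : Measurable fun x ↦ ENNReal.ofReal (ρ x) := hρ.measurable.ennreal_ofReal
  rw [h1, ← lintegral_indicator hA, chartMeasure,
    lintegral_map' (hρm.indicator hA).aemeasurable hm']
  refine (lintegral_withDensity_eq_lintegral_mul₀ hd
    ((hρm.indicator hA).comp_aemeasurable hm)).trans ?_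
  rw [← Measure.restrict_restrict_of_subset
      (inter_subset_left : e.target ∩ e.symm ⁻¹' A ⊆ e.target),
    ← lintegral_indicator hms]
  refine lintegral_congr_ae ?_
  filter_upwards [ae_restrict_mem e.open_target.measurableSet] with y hy
  rw [Pi.mul_apply, Function.comp_apply]
  by_cases hyA : e.symm y ∈ A
  · have hy' : y ∈ e.target ∩ e.symm ⁻¹' A := ⟨hy, hyA⟩
    rw [indicator_of_mem hy', indicator_of_mem hyA, mul_comm, ← ENNReal.ofReal_mul (hρ0 _)]
  · have hy' : y ∉ e.target ∩ e.symm ⁻¹' A := fun h ↦ hyA h.2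
    rw [indicator_of_notMem hy', indicator_of_notMem hyA, mul_zero]

variable {Ω} in
/-- The integrated form of `Transports`: `φ` pushes the measure `ρ₀ |Ω|` forward to `ρ₁ |Ω|`. -/
theorem Transports.setLIntegral_preimage {φ : M ≃ₘ^∞⟮𝓡 2, 𝓡 2⟯ M} {ρ₀ ρ₁ : M → ℝ}
    (h : Transports Ω φ ρ₀ ρ₁) (hρ₀ : Continuous ρ₀) (hρ₁ : Continuous ρ₁) (h₀ : ∀ x, 0 ≤ ρ₀ x)
    (h₁ : ∀ x, 0 ≤ ρ₁ x) {A : Set M} (hA : MeasurableSet A) :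
    ∫⁻ x in φ ⁻¹' A, ENNReal.ofReal (ρ₀ x) ∂areaMeasure Ω =
      ∫⁻ x in A, ENNReal.ofReal (ρ₁ x) ∂areaMeasure Ω := by
  have hφ : Measurable φ := φ.continuous.measurable
  -- equality of measures is local, and near a point each side lives in a single chart
  have key : ((areaMeasure Ω).withDensity fun x ↦ ENNReal.ofReal (ρ₀ x)).map φ =
      (areaMeasure Ω).withDensity fun x ↦ ENNReal.ofReal (ρ₁ x) := by
    refine measure_ext_of_locally fun p ↦ ?_
    refine ⟨(chartAt Plane p).source ∩ φ.symm ⁻¹' (chartAt Plane (φ.symm p)).source,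
      (chartAt Plane p).open_source.inter
        ((chartAt Plane (φ.symm p)).open_source.preimage φ.symm.continuous),
      ⟨mem_chart_source _ p, mem_chart_source _ (φ.symm p)⟩, fun B hB hBs ↦ ?_⟩
    have hB0 : φ ⁻¹' B ⊆ (chartAt Plane (φ.symm p)).source := fun x hx ↦ by
      have := (hBs hx).2
      rwa [mem_preimage, φ.symm_apply_apply] at this
    rw [Measure.map_apply hφ hB, withDensity_apply _ (hφ hB), withDensity_apply _ hB,
      setLIntegral_areaMeasure Ω p hB (hBs.trans inter_subset_left) hρ₁ h₁,
      setLIntegral_areaMeasure Ω (φ.symm p) (hφ hB) hB0 hρ₀ h₀]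
    exact (h.setLIntegral_chartDensity (chart_mem_atlas _ _) (chart_mem_atlas _ _) hB
      (hBs.trans inter_subset_left) hB0).symm
  have h2 := congrArg (fun ν ↦ ν A) key
  simpa only [Measure.map_apply hφ hA, withDensity_apply _ (hφ hA), withDensity_apply _ hA] using h2

/-- The integral of a function vanishing off a chart domain, computed in the coordinates
`coordAt p`. -/
theorem integral_areaMeasure_eq (p : M) {g : M → ℝ} (hg : Continuous g)
    (hgp : ∀ x, x ∉ (chartAt Plane p).source → g x = 0) :
    ∫ x, g x ∂areaMeasure Ω = ∫ z, (coordAt p).target.indicator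
      (fun z ↦ g ((coordAt p).symm z) * coordDensity Ω (coordAt p) z) z := by
  set e := chartAt Plane p with he
  have hm : AEMeasurable e.symm (volume.restrict e.target) :=
    e.continuousOn_symm.aemeasurable e.open_target.measurableSet
  have hm' : AEMeasurable e.symm ((volume.restrict e.target).withDensity
      fun y ↦ ENNReal.ofReal (chartDensity Ω e y)) :=
    hm.mono_ac (withDensity_absolutelyContinuous _ _)
  have hd : AEMeasurable (fun y ↦ ENNReal.ofReal (chartDensity Ω e y))
      (volume.restrict e.target) :=
    ((continuousOn_chartDensity Ω p).aemeasurable e.open_target.measurableSet).ennreal_ofReal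
  rw [← setIntegral_eq_integral_of_forall_compl_eq_zero hgp,
    areaMeasure_restrict_source Ω (chart_mem_atlas _ p), chartMeasure,
    integral_map hm' hg.measurable.aestronglyMeasurable,
    integral_withDensity_eq_integral_toReal_smul₀ hd (by simp),
    ← measurePreserving_planeEquiv.integral_comp planeEquiv.toHomeomorph.measurableEmbedding,
    ← integral_indicator e.open_target.measurableSet]
  congr 1
  funext y
  by_cases hy : y ∈ e.target
  · have hy' : planeEquiv y ∈ (coordAt p).target := by simpa [coordAt_target] using hy
    rw [indicator_of_mem hy, indicator_of_mem hy', ← chartDensity_chartAt Ω p hy,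
      coordAt_symm_apply, ContinuousLinearEquiv.symm_apply_apply, smul_eq_mul, mul_comm,
      ENNReal.toReal_ofReal (chartDensity_pos Ω p hy).le]
  · have hy' : planeEquiv y ∉ (coordAt p).target := by simpa [coordAt_target] using hy
    rw [indicator_of_notMem hy, indicator_of_notMem hy']

end AreaMeasureRegularity

/-! ### Moser's theorem for densities -/

section Moser

variable {M : Type*} [TopologicalSpace M] [T2Space M] [CompactSpace M] [ChartedSpace Plane M]
  [IsManifold (𝓡 2) ∞ M] (Ω : SymplecticForm M)

theorem exists_abs_le_of_continuous {g : M → ℝ} (hg : Continuous g) :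
    ∃ C, 0 < C ∧ ∀ x, |g x| ≤ C := by
  obtain ⟨C, hC⟩ := isCompact_univ.exists_bound_of_continuousOn hg.continuousOn
  exact ⟨max C 1, by positivity, fun x ↦ (hC x (mem_univ x)).trans (le_max_left _ _)⟩

/-- The smooth functions `g` such that every smooth density `σ` bounded below by `δ > 0` is
carried to `σ + τ g` by a diffeomorphism, as soon as `|τ|` is small in terms of `δ`. -/
def transportable : Submodule ℝ (M → ℝ) where
  carrier := {g | ContMDiff (𝓡 2) 𝓘(ℝ, ℝ) ∞ g ∧ ∀ δ > 0, ∃ τ₀ > 0, ∀ σ : M → ℝ,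
    ContMDiff (𝓡 2) 𝓘(ℝ, ℝ) ∞ σ → (∀ x, δ ≤ σ x) → ∀ τ : ℝ, |τ| ≤ τ₀ →
      ∃ φ : M ≃ₘ^∞⟮𝓡 2, 𝓡 2⟯ M, Transports Ω φ σ (σ + τ • g)}
  zero_mem' := ⟨contMDiff_const, fun δ _ ↦ ⟨1, one_pos, fun σ _ _ τ _ ↦
    ⟨Diffeomorph.refl _ _ _, by simpa using Transports.refl Ω σ⟩⟩⟩
  add_mem' := by
    rintro g₁ g₂ ⟨hg₁, h₁⟩ ⟨hg₂, h₂⟩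
    refine ⟨hg₁.add hg₂, fun δ hδ ↦ ?_⟩
    obtain ⟨C, hC, hgC⟩ := exists_abs_le_of_continuous hg₁.continuous
    obtain ⟨τ₁, hτ₁, h₁⟩ := h₁ δ hδ
    obtain ⟨τ₂, hτ₂, h₂⟩ := h₂ (δ / 2) (by positivity)
    refine ⟨min (min τ₁ τ₂) (δ / 2 / C), by positivity, fun σ hσ hδσ τ hτ ↦ ?_⟩
    rw [le_min_iff, le_min_iff] at hτ
    obtain ⟨φ, hφ⟩ := h₁ σ hσ hδσ τ hτ.1.1
    obtain ⟨ψ, hψ⟩ := h₂ (σ + τ • g₁) (hσ.add ((contMDiff_const (c := τ)).mul hg₁)) (fun x ↦ by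
      have h3 : |τ * g₁ x| ≤ δ / 2 := by
        rw [abs_mul]
        calc |τ| * |g₁ x| ≤ (δ / 2 / C) * C := by gcongr; exacts [hτ.2, hgC x]
          _ = δ / 2 := by field_simp
      have := neg_abs_le (τ * g₁ x)
      have := hδσ x
      simp only [Pi.add_apply, Pi.smul_apply, smul_eq_mul]
      linarith) τ hτ.1.2
    refine ⟨φ.trans ψ, ?_⟩
    rw [smul_add, ← add_assoc]
    exact hφ.trans hψ
  smul_mem' := by
    rintro c g ⟨hg, h⟩
    refine ⟨(contMDiff_const (c := c)).mul hg, fun δ hδ ↦ ?_⟩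
    obtain ⟨τ₀, hτ₀, h⟩ := h δ hδ
    refine ⟨τ₀ / (|c| + 1), by positivity, fun σ hσ hδσ τ hτ ↦ ?_⟩
    rw [smul_smul]
    refine h σ hσ hδσ (τ * c) ?_
    rw [abs_mul]
    calc |τ| * |c| ≤ τ₀ / (|c| + 1) * (|c| + 1) := by gcongr; linarith
      _ = τ₀ := by field_simp

variable {e : OpenPartialHomeomorph M (ℝ × ℝ)}

/-- `coordPush` is homogeneous; the scalar is moved inside the derivative so that the elementary
move applies to `τ b`. -/
theorem coordPush_smul_fderiv {b : ℝ × ℝ → ℝ} (hb : ContDiff ℝ ∞ b) (τ : ℝ) :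
    coordPush Ω e (fun z ↦ fderiv ℝ (fun z ↦ τ * b z) z (0, 1)) =
      τ • coordPush Ω e (fun z ↦ fderiv ℝ b z (0, 1)) := by
  funext x
  rw [Pi.smul_apply, coordPush, coordPush]
  by_cases hx : x ∈ e.source
  · rw [indicator_of_mem hx, indicator_of_mem hx]
    simp only [Function.comp_apply]
    rw [fderiv_const_mul (hb.differentiable (by simp) _)]
    simp [mul_div_assoc]
  · rw [indicator_of_notMem hx, indicator_of_notMem hx, smul_zero]

/-- The elementary moves along vertical lines are transportable. -/
theorem IsCoord.coordPush_fderiv_vertical_mem (he : IsCoord e) {b : ℝ × ℝ → ℝ}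
    (hb : ContDiff ℝ ∞ b) (hbc : HasCompactSupport b) (hbt : tsupport b ⊆ e.target) :
    coordPush Ω e (fun z ↦ fderiv ℝ b z (0, 1)) ∈ transportable Ω := by
  have hs : ContMDiff (𝓡 2) 𝓘(ℝ, ℝ) ∞ (coordPush Ω e (fun z ↦ fderiv ℝ b z (0, 1))) := by
    have hsub : tsupport (fun z ↦ fderiv ℝ b z (0, 1)) ⊆ tsupport b :=
      closure_minimal (fun z hz ↦ by
        by_contra h
        refine hz ?_
        beta_reduce
        rw [image_eq_zero_of_notMem_tsupport fun h' ↦ h (tsupport_fderiv_subset ℝ h')]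
        rfl) (isClosed_tsupport b)
    exact he.contMDiff_coordPush Ω ((hb.fderiv_right (by simp)).clm_apply contDiff_const)
      (hbc.of_isClosed_subset (isClosed_tsupport _) hsub) (hsub.trans hbt)
  refine ⟨hs, fun δ hδ ↦ ?_⟩
  obtain ⟨C, hC, hgC⟩ := exists_abs_le_of_continuous hs.continuous
  refine ⟨δ / 2 / C, by positivity, fun σ hσ hδσ τ hτ ↦ ?_⟩
  have h1 := coordPush_smul_fderiv Ω (e := e) hb τ
  obtain ⟨φ, hφ⟩ := he.exists_transports_add_coordPush Ω (b := fun z ↦ τ * b z)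
    (contDiff_const.mul hb) (hbc.mul_left (f := fun _ ↦ τ))
    ((tsupport_mul_subset_right (f := fun _ ↦ τ)).trans hbt) hσ
    (fun x ↦ hδ.trans_le (hδσ x)) (fun x ↦ by
      rw [h1, Pi.smul_apply, smul_eq_mul]
      set G := coordPush Ω e (fun z ↦ fderiv ℝ b z (0, 1)) x
      have h3 : |τ * G| ≤ δ / 2 := by
        rw [abs_mul]
        calc |τ| * |G| ≤ (δ / 2 / C) * C := by gcongr; exact hgC x
          _ = δ / 2 := by field_simp
      have := neg_abs_le (τ * G)
      have := hδσ x
      linarith)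
  rw [h1] at hφ
  exact ⟨φ, hφ⟩

/-- The coordinates `e` with the two coordinate functions exchanged. -/
noncomputable def coordSwap (e : OpenPartialHomeomorph M (ℝ × ℝ)) :
    OpenPartialHomeomorph M (ℝ × ℝ) := e.transHomeomorph (Homeomorph.prodComm ℝ ℝ)

theorem IsCoord.coordSwap (he : IsCoord e) : IsCoord (coordSwap e) where
  contMDiffOn := (contDiff_snd.prodMk contDiff_fst).contMDiff.comp_contMDiffOn he.contMDiffOn
  contMDiffOn_symm := he.contMDiffOn_symm.comp
    (contDiff_snd.prodMk contDiff_fst).contMDiff.contMDiffOn fun _ hz ↦ hz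

theorem IsCoord.coordDensity_coordSwap (he : IsCoord e) {z : ℝ × ℝ} (hz : z ∈ e.target) :
    coordDensity Ω (_root_.coordSwap e) z.swap = coordDensity Ω e z := by
  have h1 : HasFDerivAt (Prod.swap : ℝ × ℝ → ℝ × ℝ)
      ((ContinuousLinearMap.snd ℝ ℝ ℝ).prod (ContinuousLinearMap.fst ℝ ℝ ℝ)) z.swap :=
    hasFDerivAt_snd.prodMk hasFDerivAt_fst
  have h2 (u : ℝ × ℝ) : mfderiv 𝓘(ℝ, ℝ × ℝ) (𝓡 2) (_root_.coordSwap e).symm z.swap u =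
      mfderiv 𝓘(ℝ, ℝ × ℝ) (𝓡 2) e.symm z u.swap := by
    have h3 : mfderiv 𝓘(ℝ, ℝ × ℝ) (𝓡 2) (_root_.coordSwap e).symm z.swap =
      mfderiv 𝓘(ℝ, ℝ × ℝ) (𝓡 2) (e.symm ∘ Prod.swap) z.swap := rfl
    rw [mfderiv_comp (I' := 𝓘(ℝ, ℝ × ℝ)) z.swap
      (he.mdifferentiable.mdifferentiableAt_symm (by simpa using hz))
      h1.differentiableAt.mdifferentiableAt, mfderiv_eq_fderiv, h1.fderiv] at h3
    exact DFunLike.congr_fun h3 u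
  rw [coordDensity, coordDensity]
  refine (congrArg₂ (fun a b : Plane ↦ |Ω.form (e.symm z) a b|) (h2 (1, 0)) (h2 (0, 1))).trans ?_
  rw [← abs_neg]
  exact congrArg _ (form_swap Ω (e.symm z) _ _).symm

/-- The elementary moves along horizontal lines are transportable, by exchanging the
coordinates. -/
theorem IsCoord.coordPush_fderiv_horizontal_mem (he : IsCoord e) {a : ℝ × ℝ → ℝ}
    (ha : ContDiff ℝ ∞ a) (hac : HasCompactSupport a) (hat : tsupport a ⊆ e.target) :
    coordPush Ω e (fun z ↦ fderiv ℝ a z (1, 0)) ∈ transportable Ω := by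
  have hsupp : tsupport (a ∘ Prod.swap) = Prod.swap ⁻¹' tsupport a :=
    tsupport_comp_eq_preimage a (Homeomorph.prodComm ℝ ℝ)
  have h := he.coordSwap.coordPush_fderiv_vertical_mem Ω (b := a ∘ Prod.swap)
    (ha.comp (contDiff_snd.prodMk contDiff_fst))
    (hac.comp_homeomorph (Homeomorph.prodComm ℝ ℝ))
    (by
      rw [hsupp]
      exact fun z hz ↦ hat hz)
  convert! h using 1
  funext x
  rw [coordPush, coordPush]
  by_cases hx : x ∈ e.source
  · have hx' : x ∈ (_root_.coordSwap e).source := hx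
    rw [indicator_of_mem hx, indicator_of_mem hx']
    have h1 : _root_.coordSwap e x = (e x).swap := rfl
    have h2 : HasFDerivAt (Prod.swap : ℝ × ℝ → ℝ × ℝ)
        ((ContinuousLinearMap.snd ℝ ℝ ℝ).prod (ContinuousLinearMap.fst ℝ ℝ ℝ)) (e x).swap :=
      hasFDerivAt_snd.prodMk hasFDerivAt_fst
    simp only [Function.comp_apply]
    rw [h1, he.coordDensity_coordSwap Ω (e.map_source hx),
      ((ha.differentiable (by simp) (e x).swap.swap).hasFDerivAt.comp _ h2).fderiv]
    rfl
  · have hx' : x ∉ (_root_.coordSwap e).source := hx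
    rw [indicator_of_notMem hx, indicator_of_notMem hx']

end Moser

section MoserGlobal

variable {M : Type*} [TopologicalSpace M] [T2Space M] [CompactSpace M] [ChartedSpace Plane M]
  [IsManifold (𝓡 2) ∞ M] [MeasurableSpace M] [BorelSpace M] (Ω : SymplecticForm M)

/-- Near each point, the class of a function modulo transportable functions is determined by
its integral. -/
theorem exists_nhds_sub_integral_smul_mem_transportable (p : M) :
    ∃ W : Set M, IsOpen W ∧ p ∈ W ∧ ∃ β : M → ℝ, ∀ g : M → ℝ, ContMDiff (𝓡 2) 𝓘(ℝ, ℝ) ∞ g →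
      tsupport g ⊆ W → g - (∫ x, g x ∂areaMeasure Ω) • β ∈ transportable Ω := by
  set e := coordAt p with he
  have hcoord : IsCoord e := isCoord_coordAt p
  have hp : p ∈ e.source := mem_chart_source _ p
  obtain ⟨r, hr, hrt⟩ := Metric.isOpen_iff.1 e.open_target (e p) (e.map_source hp)
  obtain ⟨κ, hκ, hκc, hκs, hκd⟩ := exists_bump_forall_eq_add_fderiv (e p) hr
  refine ⟨e.source ∩ e ⁻¹' Metric.ball (e p) r, e.isOpen_inter_preimage Metric.isOpen_ball,
    ⟨hp, Metric.mem_ball_self hr⟩, coordPush Ω e κ, fun g hg hgs ↦ ?_⟩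
  have hgs' : tsupport g ⊆ e.source := hgs.trans inter_subset_left
  have hg0 : ∀ x, x ∉ e.source → g x = 0 := fun x hx ↦
    image_eq_zero_of_notMem_tsupport fun h ↦ hx (hgs' h)
  set h := e.target.indicator (fun z ↦ g (e.symm z) * coordDensity Ω e z) with hh
  have hK : IsCompact (e '' tsupport g) :=
    (isClosed_tsupport g).isCompact.image_of_continuousOn (e.continuousOn.mono hgs')
  have hKball : e '' tsupport g ⊆ Metric.ball (e p) r := by
    rintro _ ⟨x, hx, rfl⟩
    exact (hgs hx).2
  have hK0 : ∀ z ∈ e.target, z ∉ e '' tsupport g → g (e.symm z) * coordDensity Ω e z = 0 := by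
    intro z hz hzK
    rw [image_eq_zero_of_notMem_tsupport fun h ↦ hzK ⟨_, h, e.right_inv hz⟩, zero_mul]
  have hhs : ContDiff ℝ ∞ h := contDiff_indicator e.open_target hK (hKball.trans hrt)
    ((hg.comp_contMDiffOn hcoord.contMDiffOn_symm).contDiffOn.mul
      (hcoord.contDiffOn_coordDensity Ω)) hK0
  have hhsupp : tsupport h ⊆ Metric.ball (e p) r := by
    refine (closure_minimal (fun z hz ↦ ?_) hK.isClosed).trans hKball
    by_contra hzK
    refine hz (indicator_apply_eq_zero.2 fun hzt ↦ hK0 z hzt hzK)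
  have hint : ∫ x, g x ∂areaMeasure Ω = ∫ z, h z := integral_areaMeasure_eq Ω p hg.continuous hg0
  obtain ⟨a, b, ⟨ha, hac, has⟩, ⟨hb, hbc, hbs⟩, hab⟩ := hκd h hhs hhsupp
  rw [hint]
  convert! (transportable Ω).add_mem
    (hcoord.coordPush_fderiv_horizontal_mem Ω ha hac (has.trans hrt))
    (hcoord.coordPush_fderiv_vertical_mem Ω hb hbc (hbs.trans hrt)) using 1
  funext x
  simp only [Pi.sub_apply, Pi.add_apply, Pi.smul_apply, smul_eq_mul, coordPush]
  by_cases hx : x ∈ e.source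
  · have hgx : g x = h (e x) / coordDensity Ω e (e x) := by
      rw [hh, indicator_of_mem (e.map_source hx), e.left_inv hx,
        mul_div_cancel_right₀ _ (hcoord.coordDensity_pos Ω (e.map_source hx)).ne']
    rw [indicator_of_mem hx, indicator_of_mem hx, indicator_of_mem hx, hgx, hab (e x)]
    simp only [Function.comp_apply]
    ring
  · rw [indicator_of_notMem hx, indicator_of_notMem hx, indicator_of_notMem hx, hg0 x hx]
    simp

variable [ConnectedSpace M]

/-- On a closed connected surface, every smooth function of mean zero is transportable: modulo
transportable functions, the class of a function supported near a point is its integral times a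
class that depends on the point in a locally constant way. -/
theorem mem_transportable_of_integral_eq_zero {g : M → ℝ} (hg : ContMDiff (𝓡 2) 𝓘(ℝ, ℝ) ∞ g)
    (hint : ∫ x, g x ∂areaMeasure Ω = 0) : g ∈ transportable Ω := by
  choose W hW hpW β hβ using exists_nhds_sub_integral_smul_mem_transportable Ω
  set π := (transportable Ω).mkQ with hπ
  have key : ∀ p (f : M → ℝ), ContMDiff (𝓡 2) 𝓘(ℝ, ℝ) ∞ f → tsupport f ⊆ W p →
      π f = (∫ x, f x ∂areaMeasure Ω) • π (β p) := by
    intro p f hf hfs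
    rw [← map_smul, ← sub_eq_zero, ← map_sub]
    exact (Submodule.Quotient.mk_eq_zero _).2 (hβ p f hf hfs)
  have hloc : IsLocallyConstant fun p ↦ π (β p) := by
    rw [IsLocallyConstant.iff_eventually_eq]
    intro p
    filter_upwards [(hW p).mem_nhds (hpW p)] with p' hp'
    -- compare the two classes on a bump function supported in both neighbourhoods
    obtain ⟨f, hf0, hf1, hf⟩ := exists_contMDiffMap_zero_one_nhds_of_isClosed (n := ⊤) (𝓡 2)
      (s := (W p ∩ W p')ᶜ) (t := {p'}) ((hW p).inter (hW p')).isClosed_compl isClosed_singleton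
      (disjoint_singleton_right.2 fun h ↦ h ⟨hp', hpW p'⟩)
    have hsupp : tsupport f ⊆ W p ∩ W p' := by
      intro x hx
      by_contra hxW
      have h1 : ∀ᶠ y in 𝓝 x, f y = 0 := (Filter.Eventually.filter_mono (nhds_le_nhdsSet hxW) hf0)
      exact (notMem_tsupport_iff_eventuallyEq.2 h1) hx
    have hfs : ContMDiff (𝓡 2) 𝓘(ℝ, ℝ) ∞ f := f.contMDiff
    have hpos : 0 < ∫ x, f x ∂areaMeasure Ω := by
      refine hfs.continuous.integral_pos_of_hasCompactSupport_nonneg_nonzero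
        (HasCompactSupport.of_compactSpace _) (fun x ↦ (hf x).1) (x := p') ?_
      rw [hf1.self_of_nhdsSet p' rfl]
      exact one_ne_zero
    have h2 := (key p' f hfs (hsupp.trans inter_subset_right)).symm.trans
      (key p f hfs (hsupp.trans inter_subset_left))
    exact (smul_right_injective _ hpos.ne') h2
  obtain ⟨p₀⟩ := (inferInstance : Nonempty M)
  obtain ⟨t, ht⟩ := isCompact_univ.elim_nhds_subcover W fun p _ ↦ (hW p).mem_nhds (hpW p)
  obtain ⟨f, hf⟩ := SmoothPartitionOfUnity.exists_isSubordinate (𝓡 2) (isClosed_univ (X := M))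
    (fun p : t ↦ W p) (fun p ↦ hW p) (by rw [iUnion_subtype]; exact ht.2)
  have hsum : g = ∑ i, fun x ↦ f i x * g x := by
    funext x
    have h1 := f.sum_eq_one (mem_univ x)
    rw [finsum_eq_sum_of_fintype] at h1
    rw [Finset.sum_apply, ← Finset.sum_mul, h1, one_mul]
  have hfg : ∀ i, ContMDiff (𝓡 2) 𝓘(ℝ, ℝ) ∞ fun x ↦ f i x * g x := fun i ↦
    (f i).contMDiff.mul hg
  have h1 : π g = (∫ x, g x ∂areaMeasure Ω) • π (β p₀) := by
    conv_lhs => rw [hsum]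
    have hgint : ∫ x, g x ∂areaMeasure Ω = ∑ i, ∫ x, f i x * g x ∂areaMeasure Ω := by
      rw [← integral_finsetSum _ fun i _ ↦ (hfg i).continuous.integrable_of_hasCompactSupport
        (HasCompactSupport.of_compactSpace _)]
      congr 1
      funext x
      conv_lhs => rw [hsum]
      rw [Finset.sum_apply]
    rw [map_sum, hgint, Finset.sum_smul]
    refine Finset.sum_congr rfl fun i _ ↦ ?_
    rw [key i _ (hfg i) (tsupport_mul_subset_left.trans (hf i)),
      hloc.apply_eq_of_preconnectedSpace (i : M) p₀]
  rw [hint, zero_smul] at h1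
  exact (Submodule.Quotient.mk_eq_zero _).1 h1

/-- Moser's theorem: on a closed connected surface, smooth positive densities with the same
integral are exchanged by a diffeomorphism. -/
theorem exists_transports_of_integral_eq {ρ₀ ρ₁ : M → ℝ} (hρ₀ : ContMDiff (𝓡 2) 𝓘(ℝ, ℝ) ∞ ρ₀)
    (hρ₁ : ContMDiff (𝓡 2) 𝓘(ℝ, ℝ) ∞ ρ₁) (h₀ : ∀ x, 0 < ρ₀ x) (h₁ : ∀ x, 0 < ρ₁ x)
    (hint : ∫ x, ρ₀ x ∂areaMeasure Ω = ∫ x, ρ₁ x ∂areaMeasure Ω) :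
    ∃ φ : M ≃ₘ^∞⟮𝓡 2, 𝓡 2⟯ M, Transports Ω φ ρ₀ ρ₁ := by
  have hi {ρ : M → ℝ} (hρ : ContMDiff (𝓡 2) 𝓘(ℝ, ℝ) ∞ ρ) : Integrable ρ (areaMeasure Ω) :=
    hρ.continuous.integrable_of_hasCompactSupport (HasCompactSupport.of_compactSpace _)
  have hmin {ρ : M → ℝ} (hρ : ContMDiff (𝓡 2) 𝓘(ℝ, ℝ) ∞ ρ) (h : ∀ x, 0 < ρ x) :
      ∃ δ > 0, ∀ x, δ ≤ ρ x := by
    obtain ⟨x₀, -, hx₀⟩ := isCompact_univ.exists_isMinOn univ_nonempty hρ.continuous.continuousOn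
    exact ⟨ρ x₀, h x₀, fun x ↦ hx₀ (mem_univ x)⟩
  obtain ⟨δ₀, hδ₀, hδρ₀⟩ := hmin hρ₀ h₀
  obtain ⟨δ₁, hδ₁, hδρ₁⟩ := hmin hρ₁ h₁
  have hg : ρ₁ - ρ₀ ∈ transportable Ω := by
    refine mem_transportable_of_integral_eq_zero Ω (hρ₁.sub hρ₀) ?_
    simp only [Pi.sub_apply]
    rw [integral_sub (hi hρ₁) (hi hρ₀), hint, sub_self]
  obtain ⟨τ₀, hτ₀, hT⟩ := hg.2 (min δ₀ δ₁) (lt_min hδ₀ hδ₁)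
  obtain ⟨n, hn⟩ := exists_nat_one_div_lt hτ₀
  have hn0 : (0 : ℝ) < n + 1 := by positivity
  -- move along the segment from `ρ₀` to `ρ₁` in `n + 1` steps
  have hind : ∀ k : ℕ, k ≤ n + 1 → ∃ φ : M ≃ₘ^∞⟮𝓡 2, 𝓡 2⟯ M,
      Transports Ω φ ρ₀ (ρ₀ + ((k : ℝ) / (n + 1)) • (ρ₁ - ρ₀)) := by
    intro k
    induction k with
    | zero => exact fun _ ↦ ⟨Diffeomorph.refl _ _ _, by simpa using Transports.refl Ω ρ₀⟩
    | succ k ih =>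
      intro hk
      obtain ⟨φ, hφ⟩ := ih (by omega)
      have hk1 : (k : ℝ) / (n + 1) ≤ 1 := by
        rw [div_le_one hn0]
        exact_mod_cast (by omega : k ≤ n + 1)
      have hk0 : 0 ≤ (k : ℝ) / (n + 1) := by positivity
      obtain ⟨ψ, hψ⟩ := hT (ρ₀ + ((k : ℝ) / (n + 1)) • (ρ₁ - ρ₀))
        (hρ₀.add ((contMDiff_const (c := (k : ℝ) / (n + 1))).mul (hρ₁.sub hρ₀)))
        (fun x ↦ by
          simp only [Pi.add_apply, Pi.smul_apply, Pi.sub_apply, smul_eq_mul]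
          have e₀ := (min_le_left δ₀ δ₁).trans (hδρ₀ x)
          have e₁ := (min_le_right δ₀ δ₁).trans (hδρ₁ x)
          nlinarith) (1 / (n + 1)) (by rw [abs_of_pos (by positivity)]; exact hn.le)
      refine ⟨φ.trans ψ, ?_⟩
      convert! hφ.trans hψ using 1
      rw [add_assoc, ← add_smul]
      congr 2
      push_cast
      ring
  obtain ⟨φ, hφ⟩ := hind (n + 1) le_rfl
  refine ⟨φ, ?_⟩
  convert! hφ using 1
  push_cast
  rw [div_self hn0.ne', one_smul, add_sub_cancel]

end MoserGlobal

/-! ### Poisson brackets -/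

section Bracket

variable {M : Type*} [TopologicalSpace M] [ChartedSpace Plane M]
  [IsManifold (𝓡 2) ∞ M] (Ω : SymplecticForm M)

/-- The differential of a real function, as a covector. -/
noncomputable def differential (F : M → ℝ) (x : M) : TangentSpace (𝓡 2) x →L[ℝ] ℝ :=
  mfderiv (𝓡 2) 𝓘(ℝ, ℝ) F x

theorem form_symplecticGradient_eq_neg_differential (H : M → ℝ) (x : M)
    (v : TangentSpace (𝓡 2) x) :
    Ω.form x (symplecticGradient Ω H x) v = -differential H x v :=
  form_symplecticGradient Ω H x v

/-- In dimension two, the bracket is, up to sign, the ratio of `dG ∧ dH` and `Ω`. -/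
theorem poissonBracket_mul_form (G H : M → ℝ) (x : M) (v w : TangentSpace (𝓡 2) x) :
    poissonBracket Ω G H x * Ω.form x v w =
      -(differential G x v * differential H x w - differential G x w * differential H x v) := by
  -- the form is a multiple of a determinant, so its values satisfy the Plücker relation
  have hrel (a b c d : TangentSpace (𝓡 2) x) : Ω.form x a b * Ω.form x c d =
      Ω.form x a c * Ω.form x b d - Ω.form x a d * Ω.form x b c := by
    let A : (ℝ × ℝ) →L[ℝ] TangentSpace (𝓡 2) x := (planeEquiv.symm : (ℝ × ℝ) →L[ℝ] Plane)
    have hA : ∀ u : TangentSpace (𝓡 2) x, ∃ u' : ℝ × ℝ, A u' = u := planeEquiv.symm.surjective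
    obtain ⟨a, rfl⟩ := hA a
    obtain ⟨b, rfl⟩ := hA b
    obtain ⟨c, rfl⟩ := hA c
    obtain ⟨d, rfl⟩ := hA d
    simp only [form_apply_linear Ω A a b, form_apply_linear Ω A c d, form_apply_linear Ω A a c,
      form_apply_linear Ω A b d, form_apply_linear Ω A a d, form_apply_linear Ω A b c, cross]
    ring
  rw [poissonBracket, neg_mul, hrel]
  simp only [form_symplecticGradient_eq_neg_differential]
  ring

/-- Brackets transform by the Jacobian `ρ₀ / (ρ₁ ∘ φ)` of the diffeomorphism, in absolute value. -/
theorem abs_poissonBracket_comp {φ : M ≃ₘ^∞⟮𝓡 2, 𝓡 2⟯ M} {ρ₀ ρ₁ : M → ℝ}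
    (h : Transports Ω φ ρ₀ ρ₁) {G H : M → ℝ} (hG : ContMDiff (𝓡 2) 𝓘(ℝ, ℝ) ∞ G)
    (hH : ContMDiff (𝓡 2) 𝓘(ℝ, ℝ) ∞ H) (x : M) :
    ρ₁ (φ x) * |poissonBracket Ω (G ∘ φ) (H ∘ φ) x| =
      ρ₀ x * |poissonBracket Ω G H (φ x)| := by
  obtain ⟨v, w, hvw⟩ : ∃ v w : TangentSpace (𝓡 2) x, Ω.form x v w ≠ 0 := by
    by_contra! h0
    have h1 : (EuclideanSpace.single (0 : Fin 2) (1 : ℝ) : Plane) = 0 :=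
      Ω.nondegenerate x (EuclideanSpace.single (0 : Fin 2) (1 : ℝ) : Plane) (h0 _)
    simpa using congrFun (congrArg WithLp.ofLp h1) 0
  have hd {F : M → ℝ} (hF : ContMDiff (𝓡 2) 𝓘(ℝ, ℝ) ∞ F) (u : TangentSpace (𝓡 2) x) :
      differential (F ∘ φ) x u = differential F (φ x) (mfderiv (𝓡 2) (𝓡 2) φ x u) := by
    rw [differential, mfderiv_comp x (hF.mdifferentiable (by simp) _)
      (φ.mdifferentiable (by simp) _)]
    rfl
  have h1 := poissonBracket_mul_form Ω (G ∘ φ) (H ∘ φ) x v w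
  rw [hd hG, hd hG, hd hH, hd hH] at h1
  have h2 : |poissonBracket Ω (G ∘ φ) (H ∘ φ) x| * |Ω.form x v w| =
      |poissonBracket Ω G H (φ x)| * |Ω.form (φ x) (mfderiv (𝓡 2) (𝓡 2) φ x v)
        (mfderiv (𝓡 2) (𝓡 2) φ x w)| := by
    rw [← abs_mul, ← abs_mul]
    exact congrArg abs (h1.trans (poissonBracket_mul_form Ω G H (φ x) _ _).symm)
  refine mul_right_cancel₀ (abs_ne_zero.2 hvw) ?_
  rw [mul_assoc, h2, mul_right_comm, ← h x v w]
  ring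

/-- In coordinates the absolute value of the bracket is a Jacobian determinant divided by the
coefficient of `Ω`. -/
theorem continuous_abs_poissonBracket {G H : M → ℝ} (hG : ContMDiff (𝓡 2) 𝓘(ℝ, ℝ) ∞ G)
    (hH : ContMDiff (𝓡 2) 𝓘(ℝ, ℝ) ∞ H) : Continuous fun x ↦ |poissonBracket Ω G H x| := by
  rw [continuous_iff_continuousAt]
  intro p
  set e := coordAt p with he
  have hcoord : IsCoord e := isCoord_coordAt p
  have hs {F : M → ℝ} (hF : ContMDiff (𝓡 2) 𝓘(ℝ, ℝ) ∞ F) :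
      ContDiffOn ℝ ∞ (F ∘ e.symm) e.target :=
    (hF.comp_contMDiffOn hcoord.contMDiffOn_symm).contDiffOn
  have hd {F : M → ℝ} (hF : ContMDiff (𝓡 2) 𝓘(ℝ, ℝ) ∞ F) {z : ℝ × ℝ} (hz : z ∈ e.target)
      (u : ℝ × ℝ) : differential F (e.symm z)
        (mfderiv 𝓘(ℝ, ℝ × ℝ) (𝓡 2) e.symm z u) = fderiv ℝ (F ∘ e.symm) z u := by
    rw [← mfderiv_eq_fderiv, mfderiv_comp z (hF.mdifferentiable (by simp) _)
      (hcoord.mdifferentiable.mdifferentiableAt_symm hz)]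
    rfl
  set J : ℝ × ℝ → ℝ := fun z ↦
    |fderiv ℝ (G ∘ e.symm) z (1, 0) * fderiv ℝ (H ∘ e.symm) z (0, 1) -
      fderiv ℝ (G ∘ e.symm) z (0, 1) * fderiv ℝ (H ∘ e.symm) z (1, 0)| / coordDensity Ω e z with hJ
  have hcont {F : M → ℝ} (hF : ContMDiff (𝓡 2) 𝓘(ℝ, ℝ) ∞ F) (u : ℝ × ℝ) :
      ContinuousOn (fun z ↦ fderiv ℝ (F ∘ e.symm) z u) e.target :=
    ((hs hF).continuousOn_fderiv_of_isOpen e.open_target (by simp)).clm_apply continuousOn_const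
  have hJc : ContinuousOn J e.target := by
    refine ContinuousOn.div ?_ (hcoord.contDiffOn_coordDensity Ω).continuousOn
      fun z hz ↦ (hcoord.coordDensity_pos Ω hz).ne'
    exact (((hcont hG _).mul (hcont hH _)).sub ((hcont hG _).mul (hcont hH _))).abs
  have heq : ∀ x ∈ e.source, |poissonBracket Ω G H x| = J (e x) := by
    intro x hx
    have hz := e.map_source hx
    have h1 := poissonBracket_mul_form Ω G H (e.symm (e x))
      (mfderiv 𝓘(ℝ, ℝ × ℝ) (𝓡 2) e.symm (e x) ((1 : ℝ), (0 : ℝ)))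
      (mfderiv 𝓘(ℝ, ℝ × ℝ) (𝓡 2) e.symm (e x) ((0 : ℝ), (1 : ℝ)))
    rw [hd hG hz, hd hG hz, hd hH hz, hd hH hz] at h1
    have h2 := congrArg abs h1
    rw [abs_neg, abs_mul, e.left_inv hx] at h2
    rw [hJ, eq_div_iff (hcoord.coordDensity_pos Ω hz).ne']
    refine Eq.trans ?_ h2
    rw [coordDensity, e.left_inv hx]
  have hp : p ∈ e.source := mem_chart_source _ p
  refine ContinuousAt.congr (f := J ∘ e) ?_ ?_
  · exact (hJc.continuousAt (e.open_target.mem_nhds (e.map_source hp))).comp (e.continuousAt hp)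
  · filter_upwards [e.open_source.mem_nhds hp] with x hx using (heq x hx).symm

theorem continuous_bracketFunction {N : ℕ} {f : Fin N → M → ℝ}
    (hf : ∀ i, ContMDiff (𝓡 2) 𝓘(ℝ, ℝ) ∞ (f i)) : Continuous (bracketFunction Ω f) :=
  continuous_finsetSum _ fun i _ ↦ continuous_finsetSum _ fun j _ ↦
    continuous_abs_poissonBracket Ω (hf i) (hf j)

theorem symplecticGradient_sum {N : ℕ} {f : Fin N → M → ℝ}
    (hf : ∀ i, ContMDiff (𝓡 2) 𝓘(ℝ, ℝ) ∞ (f i)) (a : Fin N → ℝ) (x : M) :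
    symplecticGradient Ω (fun x ↦ ∑ i, a i * f i x) x =
      ∑ i, a i • symplecticGradient Ω (f i) x := by
  have h2 (s : Finset (Fin N)) : ∃ D : TangentSpace (𝓡 2) x →L[ℝ] ℝ,
      D = ∑ i ∈ s, a i • differential (f i) x ∧
      HasMFDerivAt (𝓡 2) 𝓘(ℝ, ℝ) (fun x ↦ ∑ i ∈ s, a i * f i x) x D := by
    classical
    induction s using Finset.induction_on with
    | empty => exact ⟨0, rfl, hasMFDerivAt_const (I := 𝓡 2) (I' := 𝓘(ℝ, ℝ)) (0 : ℝ) x⟩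
    | insert i s hi ih =>
      obtain ⟨D, hD, ih⟩ := ih
      refine ⟨a i • differential (f i) x + D, by rw [Finset.sum_insert hi, hD], ?_⟩
      exact ((((hf i).mdifferentiable (by simp) x).hasMFDerivAt.const_smul (a i)).add
        ih).congr_of_eventuallyEq (Filter.Eventually.of_forall fun y ↦ Finset.sum_insert hi)
  have h1 : differential (fun x ↦ ∑ i, a i * f i x) x = ∑ i, a i • differential (f i) x := by
    obtain ⟨D, hD, h⟩ := h2 Finset.univ
    rw [← hD]
    exact h.mfderiv
  change (flat Ω x).symm (-differential _ x) = ∑ i, a i • (flat Ω x).symm (-differential _ x)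
  rw [h1, ← Finset.sum_neg_distrib, map_sum]
  refine Finset.sum_congr rfl fun i _ ↦ ?_
  rw [map_neg, map_smul, map_neg, smul_neg]

/-- By bilinearity of the bracket, coefficients in `[-1, 1]` give at most the sum of the
`|{f_i, f_j}|`. -/
theorem pb_le_of_forall_bracketFunction_le [Nonempty M] {N : ℕ} {f : Fin N → M → ℝ}
    (hf : ∀ i, ContMDiff (𝓡 2) 𝓘(ℝ, ℝ) ∞ (f i)) {C : ℝ} (hC : ∀ x, bracketFunction Ω f x ≤ C) :
    pb Ω f ≤ C := by
  have : Nonempty ((Fin N → Icc (-1 : ℝ) 1) × (Fin N → Icc (-1 : ℝ) 1)) :=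
    ⟨⟨fun _ ↦ ⟨0, by norm_num⟩, fun _ ↦ ⟨0, by norm_num⟩⟩⟩
  refine ciSup_le fun c ↦ ciSup_le fun x ↦ (le_trans ?_ (hC x))
  have h1 : poissonBracket Ω (fun x ↦ ∑ i, (c.1 i : ℝ) * f i x)
      (fun x ↦ ∑ j, (c.2 j : ℝ) * f j x) x =
      ∑ i, ∑ j, (c.1 i : ℝ) * (c.2 j : ℝ) * poissonBracket Ω (f i) (f j) x := by
    simp only [poissonBracket]
    rw [symplecticGradient_sum Ω hf, symplecticGradient_sum Ω hf, map_sum]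
    simp only [sum_apply, map_smul, smul_apply, map_sum, smul_eq_mul, Finset.mul_sum,
      ← Finset.sum_neg_distrib]
    rw [Finset.sum_comm]
    refine Finset.sum_congr rfl fun i _ ↦ Finset.sum_congr rfl fun j _ ↦ ?_
    ring
  rw [h1, bracketFunction]
  refine (Finset.abs_sum_le_sum_abs _ _).trans (Finset.sum_le_sum fun i _ ↦
    (Finset.abs_sum_le_sum_abs _ _).trans (Finset.sum_le_sum fun j _ ↦ ?_))
  rw [abs_mul, abs_mul]
  have h2 : |(c.1 i : ℝ)| ≤ 1 := abs_le.2 (c.1 i).2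
  have h3 : |(c.2 j : ℝ)| ≤ 1 := abs_le.2 (c.2 j).2
  calc _ ≤ 1 * 1 * |poissonBracket Ω (f i) (f j) x| := by gcongr
    _ = _ := by ring

end Bracket

/-! ### Equidistributing the bracket function -/

section Equidistribution

variable {M : Type*} [TopologicalSpace M] [ChartedSpace Plane M] [IsManifold (𝓡 2) ∞ M]
  (Ω : SymplecticForm M)

theorem bracketFunction_nonneg {N : ℕ} (f : Fin N → M → ℝ) (x : M) : 0 ≤ bracketFunction Ω f x :=
  Finset.sum_nonneg fun _ _ ↦ Finset.sum_nonneg fun _ _ ↦ abs_nonneg _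

variable {Ω} in
theorem Transports.mul_bracketFunction_comp {φ : M ≃ₘ^∞⟮𝓡 2, 𝓡 2⟯ M} {ρ₀ ρ₁ : M → ℝ}
    (h : Transports Ω φ ρ₀ ρ₁) {N : ℕ} {f : Fin N → M → ℝ}
    (hf : ∀ i, ContMDiff (𝓡 2) 𝓘(ℝ, ℝ) ∞ (f i)) (x : M) :
    ρ₁ (φ x) * bracketFunction Ω (fun i ↦ f i ∘ φ) x = ρ₀ x * bracketFunction Ω f (φ x) := by
  simp only [bracketFunction, Finset.mul_sum, abs_poissonBracket_comp Ω h (hf _) (hf _)]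

variable [MeasurableSpace M] [BorelSpace M] [CompactSpace M]

theorem Continuous.integrable_areaMeasure {g : M → ℝ} (hg : Continuous g) :
    Integrable g (areaMeasure Ω) :=
  hg.integrable_of_hasCompactSupport (HasCompactSupport.of_compactSpace _)

theorem area_pos [Nonempty M] : 0 < area Ω := by
  rw [area, measureReal_def]
  exact ENNReal.toReal_pos (isOpen_univ.measure_ne_zero _ univ_nonempty) (measure_ne_top _ _)

variable {Ω} in
/-- When a constant density `c` is carried to `ρ`, the area of a preimage is read off from the
integral of `ρ`. -/
theorem Transports.mul_real_preimage {φ : M ≃ₘ^∞⟮𝓡 2, 𝓡 2⟯ M} {c : ℝ} {ρ : M → ℝ}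
    (h : Transports Ω φ (fun _ ↦ c) ρ) (hρ : Continuous ρ) (hc : 0 ≤ c) (h₀ : ∀ x, 0 ≤ ρ x)
    {A : Set M} (hA : MeasurableSet A) :
    c * (areaMeasure Ω).real (φ ⁻¹' A) = ∫ x in A, ρ x ∂areaMeasure Ω := by
  rw [integral_eq_lintegral_of_nonneg_ae (Filter.Eventually.of_forall h₀)
    hρ.measurable.aestronglyMeasurable,
    ← h.setLIntegral_preimage continuous_const hρ (fun _ ↦ hc) h₀ hA, setLIntegral_const,
    ENNReal.toReal_mul, ENNReal.toReal_ofReal hc, measureReal_def]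

variable [T2Space M] [ConnectedSpace M]

/-- Every continuous density `P ≥ 0` is dominated, up to `δ`, by a smooth density that a
diffeomorphism makes constant. -/
theorem exists_transports_const {P : M → ℝ} (hP : Continuous P) (hP₀ : ∀ x, 0 ≤ P x) {δ : ℝ}
    (hδ : 0 < δ) : ∃ (φ : M ≃ₘ^∞⟮𝓡 2, 𝓡 2⟯ M) (c : ℝ) (ρ : M → ℝ), 0 < c ∧ Continuous ρ ∧
      (∀ x, 0 < ρ x ∧ P x ≤ ρ x ∧ ρ x ≤ P x + δ) ∧
      c * area Ω = ∫ x, ρ x ∂areaMeasure Ω ∧ Transports Ω φ (fun _ ↦ c) ρ := by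
  obtain ⟨ρ, hρ⟩ := exists_contMDiffMap_forall_mem_convex_of_local_const (n := ⊤) (𝓡 2)
    (t := fun x ↦ Ioo (P x) (P x + δ)) (fun x ↦ convex_Ioo _ _) (fun x ↦
      ⟨P x + δ / 2, by
        filter_upwards [hP.continuousAt.eventually (Ioo_mem_nhds
          (by linarith : P x - δ / 2 < P x) (by linarith : P x < P x + δ / 2))] with y hy
        exact ⟨hy.2, by linarith [hy.1]⟩⟩)
  have hρs : ContMDiff (𝓡 2) 𝓘(ℝ, ℝ) ∞ ρ := ρ.contMDiff
  have hρ0 : ∀ x, 0 < ρ x := fun x ↦ (hP₀ x).trans_lt (hρ x).1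
  have hA := area_pos Ω
  obtain ⟨x₀⟩ := (inferInstance : Nonempty M)
  have hint : 0 < ∫ x, ρ x ∂areaMeasure Ω :=
    hρs.continuous.integral_pos_of_hasCompactSupport_nonneg_nonzero
      (HasCompactSupport.of_compactSpace _) (fun x ↦ (hρ0 x).le) (hρ0 x₀).ne'
  have hc : (∫ x, ρ x ∂areaMeasure Ω) / area Ω * area Ω = ∫ x, ρ x ∂areaMeasure Ω :=
    div_mul_cancel₀ _ hA.ne'
  obtain ⟨φ, hφ⟩ := exists_transports_of_integral_eq Ω
    (ρ₀ := fun _ ↦ (∫ x, ρ x ∂areaMeasure Ω) / area Ω) contMDiff_const hρs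
    (fun _ ↦ div_pos hint hA) hρ0 (by
      rw [integral_const, smul_eq_mul, mul_comm]
      exact hc)
  exact ⟨φ, _, ρ, div_pos hint hA, hρs.continuous,
    fun x ↦ ⟨hρ0 x, (hρ x).1.le, (hρ x).2.le⟩, hc, hφ⟩

end Equidistribution

theorem mainTheorem7 {M : Type*} [TopologicalSpace M] [T2Space M] [CompactSpace M]
    [ConnectedSpace M] [ChartedSpace Plane M] [IsManifold (𝓡 2) ∞ M]
    [MeasurableSpace M] [BorelSpace M] (Ω : SymplecticForm M)
    {N : ℕ} (U : Fin N → Set M) (hU : IsOpenCover U) (hdisc : ∀ i, IsOpenDisc (U i))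
    (hgen : InGeneralPosition U)
    (f : Fin N → M → ℝ) (hf : IsPositiveCollection f) (hfU : IsSubordinate f U)
    (ε : ℝ) (hε : 0 < ε) (η : ℝ) (hη : 0 < η) :
    ∃ φ : M ≃ₘ^∞⟮𝓡 2, 𝓡 2⟯ M, ∃ (f' : Fin N → M → ℝ) (U' : Fin N → Set M),
      (∀ i, f' i = f i ∘ φ) ∧ (∀ i, U' i = φ ⁻¹' U i) ∧
      IsOpenCover U' ∧ IsPositiveCollection f' ∧ IsSubordinate f' U' ∧
      (∀ x, bracketFunction Ω f' x <
        (∫ y, bracketFunction Ω f y ∂areaMeasure Ω) / area Ω + ε) ∧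
      (0 < ∫ y, bracketFunction Ω f y ∂areaMeasure Ω →
        capacity Ω U' <
          (⨆ i, (∫ y in U i, bracketFunction Ω f y ∂areaMeasure Ω) /
            ∫ y, bracketFunction Ω f y ∂areaMeasure Ω) * area Ω + ε) ∧
      pb Ω f' * area Ω < (∫ y, bracketFunction Ω f y ∂areaMeasure Ω) + η ∧
      pb Ω f' * capacity Ω U' <
        (⨆ i, ∫ y in U i, bracketFunction Ω f y ∂areaMeasure Ω) + η := by
  set P := bracketFunction Ω f with hPdef
  set I := ∫ y, P y ∂areaMeasure Ω with hI
  set A := area Ω with hAdef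
  have hA : 0 < A := area_pos Ω
  have hP : Continuous P := continuous_bracketFunction Ω hf.1
  have hP₀ : ∀ x, 0 ≤ P x := bracketFunction_nonneg Ω f
  have hPi := hP.integrable_areaMeasure Ω
  have : Nonempty (Fin N) := by
    obtain ⟨x⟩ := (inferInstance : Nonempty M)
    obtain ⟨i, -⟩ := mem_iUnion.1 (hU.2 ▸ mem_univ x : x ∈ ⋃ i, U i)
    exact ⟨i⟩
  -- the last condition only matters for `I > 0`; for `I = 0` it is vacuous as `x / 0 = 0`
  obtain ⟨δ, hδ, hδε, hδη, hδI⟩ : ∃ δ > 0, δ < ε ∧ δ * A < η ∧ δ * A * A / I < ε := by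
    have h1 : ∀ᶠ δ in 𝓝[>] (0 : ℝ), δ < ε ∧ δ * A < η ∧ δ * A * A / I < ε := by
      refine Filter.Eventually.filter_mono nhdsWithin_le_nhds
        (.and (eventually_lt_nhds hε) (.and ?_ ?_))
      · exact (by fun_prop : Continuous fun δ : ℝ ↦ δ * A).continuousAt.eventually_lt
          continuousAt_const (by simpa using hη)
      · exact (by fun_prop : Continuous fun δ : ℝ ↦ δ * A * A / I).continuousAt.eventually_lt
          continuousAt_const (by simpa using hε)
    obtain ⟨δ, h2, h3⟩ := (h1.and self_mem_nhdsWithin).exists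
    exact ⟨δ, h3, h2⟩
  obtain ⟨φ, c, ρ, hc, hρ, hρP, hcA, hφ⟩ := exists_transports_const Ω hP hP₀ hδ
  have hρi := hρ.integrable_areaMeasure Ω
  have hset (B : Set M) : ∫ y in B, ρ y ∂areaMeasure Ω ≤
      (∫ y in B, P y ∂areaMeasure Ω) + δ * A := by
    calc ∫ y in B, ρ y ∂areaMeasure Ω ≤ ∫ y in B, (P y + δ) ∂areaMeasure Ω :=
          integral_mono hρi.restrict (hPi.add (integrable_const δ)).restrict fun x ↦ (hρP x).2.2
      _ = (∫ y in B, P y ∂areaMeasure Ω) + δ * (areaMeasure Ω).real B := by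
          rw [integral_add hPi.restrict (integrable_const δ)]
          simp [mul_comm]
      _ ≤ _ := by
          have : (areaMeasure Ω).real B ≤ A := measureReal_mono (subset_univ B)
          gcongr
  have hcI : c * A ≤ I + δ * A := by
    rw [hcA]
    simpa using hset univ
  have hIc : I ≤ c * A := by
    rw [hcA]
    exact integral_mono hPi hρi fun x ↦ (hρP x).2.1
  have hfs : ∀ i, ContMDiff (𝓡 2) 𝓘(ℝ, ℝ) ∞ (f i ∘ φ) := fun i ↦ (hf.1 i).comp φ.contMDiff
  have hP' : ∀ x, bracketFunction Ω (fun i ↦ f i ∘ φ) x ≤ c := fun x ↦ by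
    have h1 := hφ.mul_bracketFunction_comp hf.1 x
    have h2 : c * bracketFunction Ω f (φ x) ≤ c * ρ (φ x) :=
      mul_le_mul_of_nonneg_left (hρP (φ x)).2.1 hc.le
    rw [← h1, mul_comm c] at h2
    exact le_of_mul_le_mul_left h2 (hρP (φ x)).1
  have hpb : pb Ω (fun i ↦ f i ∘ φ) ≤ c := pb_le_of_forall_bracketFunction_le Ω hfs hP'
  have hcU (i : Fin N) : c * (areaMeasure Ω).real (φ ⁻¹' U i) ≤
      (∫ y in U i, P y ∂areaMeasure Ω) + δ * A := by
    rw [hφ.mul_real_preimage hρ hc.le (fun x ↦ (hρP x).1.le) (hU.1 i).measurableSet]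
    exact hset _
  refine ⟨φ, fun i ↦ f i ∘ φ, fun i ↦ φ ⁻¹' U i, fun _ ↦ rfl, fun _ ↦ rfl,
    ⟨fun i ↦ (hU.1 i).preimage φ.continuous, by rw [← preimage_iUnion, hU.2, preimage_univ]⟩,
    ⟨hfs, fun i x ↦ hf.2.1 i _, fun x ↦ hf.2.2 _⟩,
    fun i ↦ (tsupport_comp_subset_preimage _ φ.continuous).trans (preimage_mono (hfU i)),
    fun x ↦ (hP' x).trans_lt ?_, fun hIpos ↦ ?_, ?_, ?_⟩
  · have h1 : c ≤ I / A + δ := by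
      rw [← sub_le_iff_le_add, le_div_iff₀ hA]
      linarith
    linarith
  · refine lt_of_le_of_lt (ciSup_le fun i ↦ ?_ : capacity Ω _ ≤
      (⨆ i, (∫ y in U i, P y ∂areaMeasure Ω) / I) * A + δ * A * A / I) (by linarith)
    have h1 : (∫ y in U i, P y ∂areaMeasure Ω) / I ≤
        ⨆ i, (∫ y in U i, P y ∂areaMeasure Ω) / I :=
      le_ciSup (f := fun i ↦ (∫ y in U i, P y ∂areaMeasure Ω) / I) (finite_range _).bddAbove i
    have h2 : I * (areaMeasure Ω).real (φ ⁻¹' U i) ≤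
        ((∫ y in U i, P y ∂areaMeasure Ω) + δ * A) * A := by
      calc I * (areaMeasure Ω).real (φ ⁻¹' U i) ≤ c * A * (areaMeasure Ω).real (φ ⁻¹' U i) := by
            gcongr
        _ = c * (areaMeasure Ω).real (φ ⁻¹' U i) * A := by ring
        _ ≤ _ := by gcongr; exact hcU i
    calc (areaMeasure Ω).real (φ ⁻¹' U i) ≤
          ((∫ y in U i, P y ∂areaMeasure Ω) + δ * A) * A / I := by
            rw [le_div_iff₀ hIpos, mul_comm]
            exact h2
      _ = (∫ y in U i, P y ∂areaMeasure Ω) / I * A + δ * A * A / I := by ring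
      _ ≤ _ := by gcongr
  · calc _ ≤ c * A := by gcongr
      _ < _ := by linarith
  · obtain ⟨i, hi⟩ := exists_eq_ciSup_of_finite (f := fun i ↦ (areaMeasure Ω).real (φ ⁻¹' U i))
    have h1 : (∫ y in U i, P y ∂areaMeasure Ω) ≤ ⨆ i, ∫ y in U i, P y ∂areaMeasure Ω :=
      le_ciSup (f := fun i ↦ ∫ y in U i, P y ∂areaMeasure Ω) (finite_range _).bddAbove i
    have h2 : capacity Ω (fun i ↦ φ ⁻¹' U i) = (areaMeasure Ω).real (φ ⁻¹' U i) := hi.symm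
    rw [h2]
    calc _ ≤ c * (areaMeasure Ω).real (φ ⁻¹' U i) := by gcongr
      _ ≤ _ := hcU i
      _ < _ := by linarith
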